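/- Let $d \ge 3$ be an integer and $p$ a prime number, and consider the rational map $$f = f_{d,p} \colon \mathbb{P}^2_{\overline{\mathbb Q}} \dashrightarrow \mathbb{P}^2_{\overline{\mathbb Q}},\qquad (x:y:z) \mapsto \Bigl(x^d - \tfrac{1}{p^{d-3}}\, y^2 z^{d-2} : x y^2 z^{d-3} : y^2 z^{d-2}\Bigr).$$ Write $I_f$ for its indeterminacy locus. For $i = 1, 2$ let $d_i(f) = \lim_{n\to\infty} \bigl((f^n)^*H^i \cdot H^{2-i}\bigr)^{1/n}$ be the $i$-th dynamical degree, where $H \subset \mathbb{P}^2$ is a line; thus $(f^n)^*H\cdot H$ is the algebraic degree of $f^n$ (the degree of the coordinates of $f^n$ after removal of common factors) and $(f^n)^*H^2$ is its topological degree $[\overline{\mathbb Q}(\mathbb{P}^2) : (f^n)^*\overline{\mathbb Q}(\mathbb{P}^2)]$. A dominant rational self-map of $\mathbb{P}^2$ is $q$-cohomologically hyperbolic if $q$ is the unique index in $\{1,2\}$ at which $d_i$ attains its maximum. A rational self-map $g$ of $\mathbb{P}^2$, with graph $\Gamma_g \subset \mathbb{P}^2\times\mathbb{P}^2$ (the Zariski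 closure of its graph on $\mathbb{P}^2\setminus I_g$) and projections $\pi_1, \pi_2 \colon \Gamma_g \to \mathbb{P}^2$, is finite over an open set $U \subset \mathbb{P}^2$ if $\pi_2^{-1}(U) \to U$ is a finite morphism and $\pi_2^{-1}(U) \cap \pi_1^{-1}(I_g) = \emptyset$. Let $(\mathbb{P}^2)_f^{\mathrm{back}}$ be the set of points $P$ such that for every $n \ge 1$ there is a Zariski open neighbourhood of $P$ over which $f^n$ is finite. 1. The limits $d_1(f)$ and $d_2(f)$ exist, $d_1(f) = d$ and $d_2(f) = 2$. In particular, $f$ is (dominant and) $1$-cohomologically hyperbolic. 2. Let $d = 4$, $p = 2$ and $P_0 = \bigl(\frac{1+\sqrt 3}{2} : \frac{1+\sqrt 3}{2} : 1\bigr)$, where $\sqrt 3 \in \overline{\mathbb Q}$ is a square root of $3$. Then $f(P_0) = P_0$, $P_0 \in (\mathbb{P}^2)_f^{\mathrm{back}}$, and there is a sequence of points $P_n \in (\mathbb{P}^2 \setminus I_f)(\overline{\mathbb Q})$, $n \ge 1$, such that $f(P_n) = P_{n-1}$ for all $n \ge 1$, the set $\{P_n \mid n \ge 0\}$ is Zariski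 dense in $\mathbb{P}^2$, and $\lim_{n\to\infty} h(P_n) = \infty$, where $h$ is the absolute logarithmic naive height on $\mathbb{P}^2(\overline{\mathbb Q})$. -/

import Mathlib

open MvPolynomial Filter Topology
open scoped LinearAlgebra.Projectivization

noncomputable section

namespace UnbddPreper

/-! ### Varieties as sets of points with regular functions -/

section Varieties

/-- The data generating a Zariski topology and a sheaf of regular functions on a set of points `X`:
a collection of pairs `(D, ψ)`, where `D` is a basic open set and `ψ` is a basic regular function
on `D` (only the values of `ψ` on `D` matter). -/
abbrev Basics (k : Type*) (X : Type*) := Set (Set X × (X → k))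

variable {k X Y : Type*}

/-- The topology generated by the basic open sets. -/
abbrev Basics.top (𝒳 : Basics k X) : TopologicalSpace X :=
  TopologicalSpace.generateFrom {D | ∃ ψ, (D, ψ) ∈ 𝒳}

/-- `T` is open in the subset `S`, for the induced topology. -/
def Basics.OpenIn (𝒳 : Basics k X) (S T : Set X) : Prop :=
  ∃ O, IsOpen[𝒳.top] O ∧ T = S ∩ O

/-- `φ` is regular on the subset `S` (with the induced structure): locally on `S`
it agrees with a basic regular function. -/
def Basics.RegularOn (𝒳 : Basics k X) (S : Set X) (φ : X → k) : Prop :=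
  ∀ x ∈ S, ∃ D ψ, (D, ψ) ∈ 𝒳 ∧ x ∈ D ∧ ∀ y ∈ S ∩ D, φ y = ψ y

/-- `u` restricts to a morphism `S → T`: it is continuous and pulls regular functions back to
regular functions. -/
def IsMorphism (𝒳 : Basics k X) (𝒴 : Basics k Y) (u : X → Y) (S : Set X) (T : Set Y) : Prop :=
  Set.MapsTo u S T ∧ ∀ D ψ, (D, ψ) ∈ 𝒴 →
    𝒳.OpenIn S (S ∩ u ⁻¹' D) ∧ 𝒳.RegularOn (S ∩ u ⁻¹' D) (ψ ∘ u)

/-- `S` and `T` are isomorphic. -/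
def AreIsomorphic (𝒳 : Basics k X) (𝒴 : Basics k Y) (S : Set X) (T : Set Y) : Prop :=
  ∃ (u : X → Y) (v : Y → X), IsMorphism 𝒳 𝒴 u S T ∧ IsMorphism 𝒴 𝒳 v T S ∧
    (∀ x ∈ S, v (u x) = x) ∧ ∀ y ∈ T, u (v y) = y

variable (k) in
/-- Affine space `𝔸ᵐ(k)`. -/
def affineSpace [Field k] (m : ℕ) : Basics k (Fin m → k) :=
  {q | ∃ A B : MvPolynomial (Fin m) k,
    q = ({x | eval x B ≠ 0}, fun x => eval x A / eval x B)}

/-- `S` is affine: isomorphic to a Zariski closed subset of some affine space. -/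
def Basics.IsAffine [Field k] (𝒳 : Basics k X) (S : Set X) : Prop :=
  ∃ (m : ℕ) (Z : Set (Fin m → k)), IsClosed[(affineSpace k m).top] Z ∧
    AreIsomorphic 𝒳 (affineSpace k m) S Z

/-- `g` restricts to a finite morphism `S → T`: `T` is covered by affine open subsets `W`
such that `g⁻¹(W)` is affine and `𝒪(g⁻¹(W))` is a finitely generated `𝒪(W)`-module. -/
def IsFiniteMorphism [Field k] (𝒳 : Basics k X) (𝒴 : Basics k Y) (g : X → Y)
    (S : Set X) (T : Set Y) : Prop :=
  IsMorphism 𝒳 𝒴 g S T ∧ ∀ Q ∈ T, ∃ W, Q ∈ W ∧ 𝒴.OpenIn T W ∧ 𝒴.IsAffine W ∧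
    𝒳.IsAffine (S ∩ g ⁻¹' W) ∧
    ∃ (r : ℕ) (b : Fin r → X → k), (∀ i, 𝒳.RegularOn (S ∩ g ⁻¹' W) (b i)) ∧
      ∀ φ, 𝒳.RegularOn (S ∩ g ⁻¹' W) φ →
        ∃ a : Fin r → Y → k, (∀ i, 𝒴.RegularOn W (a i)) ∧
          ∀ x ∈ S ∩ g ⁻¹' W, φ x = ∑ i, a i (g x) * b i x

end Varieties

/-! ### The projective plane and its rational self-maps -/

section Plane

variable (k : Type*) [Field k]

/-- The points of the projective plane. -/
abbrev P2 := ℙ k (Fin 3 → k)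

/-- The projective plane: the basic open sets are the `D₊(B)`, the basic regular functions are
quotients of homogeneous polynomials of the same degree. -/
def plane : Basics k (P2 k) :=
  {q | ∃ (e : ℕ) (A B : MvPolynomial (Fin 3) k), A.IsHomogeneous e ∧ B.IsHomogeneous e ∧
    q = ({P | eval P.rep B ≠ 0}, fun P => eval P.rep A / eval P.rep B)}

/-- The bidegree of the variables of `k[x₀, x₁, x₂, y₀, y₁, y₂]`. -/
def biweight : Fin 3 ⊕ Fin 3 → ℕ × ℕ := Sum.elim (fun _ => (1, 0)) (fun _ => (0, 1))

/-- The product `ℙ² × ℙ²`: the basic regular functions are quotients of bihomogeneous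
polynomials of the same bidegree. -/
def planeSq : Basics k (P2 k × P2 k) :=
  {q | ∃ (e : ℕ × ℕ) (A B : MvPolynomial (Fin 3 ⊕ Fin 3) k),
    A.IsWeightedHomogeneous biweight e ∧ B.IsWeightedHomogeneous biweight e ∧
    q = ({R | eval (Sum.elim R.1.rep R.2.rep) B ≠ 0}, fun R =>
      eval (Sum.elim R.1.rep R.2.rep) A / eval (Sum.elim R.1.rep R.2.rep) B)}

/-- Triples of polynomials; a nonzero triple `F` of homogeneous polynomials of the same degree
represents the rational map `(F₀ : F₁ : F₂)` from `ℙ²` to itself. -/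
abbrev Triple := Fin 3 → MvPolynomial (Fin 3) k

variable {k}

/-- `G` is a nonzero triple of homogeneous polynomials of degree `e` that represents the same
rational map as `F`. -/
def Represents (F G : Triple k) (e : ℕ) : Prop :=
  G ≠ 0 ∧ (∀ i, (G i).IsHomogeneous e) ∧ ∀ i j, F i * G j = F j * G i

/-- The rational map `F` is defined at `P` and its value there is `Q`. -/
def Sends (F : Triple k) (P Q : P2 k) : Prop :=
  ∃ (e : ℕ) (G : Triple k), Represents F G e ∧
    ∃ h : (fun i => eval P.rep (G i)) ≠ 0, Q = Projectivization.mk k _ h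

/-- The indeterminacy locus `I_f`. -/
def indet (F : Triple k) : Set (P2 k) := {P | ¬ ∃ Q, Sends F P Q}

/-- The rational map `F` is dominant. -/
def IsDominant (F : Triple k) : Prop :=
  @Dense _ (plane k).top {Q | ∃ P, Sends F P Q}

/-- The iterates of a rational map. -/
def iter (F : Triple k) : ℕ → Triple k
  | 0 => X
  | n + 1 => fun i => bind₁ (iter F n) (F i)

/-! ### Dynamical degrees -/

/-- The algebraic degree of a rational self-map of `ℙ²`: the integer `e` with `f^*𝒪(1) = 𝒪(e)`,
that is, the degree of a representative without common factor, which is the least degree of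
all representatives. -/
def algDegree (F : Triple k) : ℕ := sInf {e | ∃ G, Represents F G e}

/-- For a triple `F` with nonzero entries, the field generated over `k` by the quotients
`F i / F j`. -/
def quotField (F : Triple k) : IntermediateField k (FractionRing (MvPolynomial (Fin 3) k)) :=
  IntermediateField.adjoin k
    {q | ∃ i j, q = algebraMap (MvPolynomial (Fin 3) k) (FractionRing (MvPolynomial (Fin 3) k)) (F i)
      / algebraMap (MvPolynomial (Fin 3) k) (FractionRing (MvPolynomial (Fin 3) k)) (F j)}

/-- The topological degree `[k(ℙ²) : f^* k(ℙ²)]` of a rational self-map of `ℙ²`, which is the degree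
of the second projection of its graph. Here `k(ℙ²)` is generated by the quotients `xᵢ / xⱼ`, and
`f^* k(ℙ²)` by the quotients `Fᵢ / Fⱼ`. -/
def topDegree (F : Triple k) : ℕ := IntermediateField.relfinrank (quotField F) (quotField X)

/-- The intersection number `(f^* H^i · H^(2 - i))`, with `H` a line in `ℙ²`, computed on the graph
of `f`. -/
def degreeOf (F : Triple k) : ℕ → ℕ
  | 0 => 1
  | 1 => algDegree F
  | 2 => topDegree F
  | _ => 0

/-- The `i`-th dynamical degree `lim_n ((f^n)^* H^i · H^(2 - i))^(1/n)` exists and is `δ`. -/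
def HasDynDegree (F : Triple k) (i : ℕ) (δ : ℝ) : Prop :=
  Tendsto (fun n : ℕ => (degreeOf (iter F n) i : ℝ) ^ (1 / (n : ℝ))) atTop (𝓝 δ)

/-- The dominant rational map `F` is `q`-cohomologically hyperbolic: `q` is the unique index
in `{1, 2}` at which the dynamical degree is maximal. -/
def IsCohHyperbolic (F : Triple k) (q : ℕ) : Prop :=
  IsDominant F ∧ ∃ δ : ℕ → ℝ, (∀ i ∈ Finset.Icc 1 2, HasDynDegree F i (δ i)) ∧
    ∀ j, (j ∈ Finset.Icc 1 2 ∧ ∀ i ∈ Finset.Icc 1 2, δ i ≤ δ j) ↔ j = q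

/-! ### Finiteness over open sets -/

/-- The graph of a rational map: the Zariski closure in `ℙ² × ℙ²` of the graph on the domain. -/
def graph (F : Triple k) : Set (P2 k × P2 k) :=
  @closure _ (planeSq k).top {R | Sends F R.1 R.2}

/-- `F` is finite over `U`: the projection `g` of the graph to the target is finite over `U`, and
`g⁻¹(U)` does not meet the inverse image of the indeterminacy locus. -/
def FiniteOver (F : Triple k) (U : Set (P2 k)) : Prop :=
  IsFiniteMorphism (planeSq k) (plane k) Prod.snd (graph F ∩ Prod.snd ⁻¹' U) U ∧
    ∀ R ∈ graph F, R.2 ∈ U → R.1 ∉ indet F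

/-- The set of points `P` such that every iterate is finite over a neighbourhood of `P`. -/
def backLocus (F : Triple k) : Set (P2 k) :=
  {P | ∀ n, 1 ≤ n → ∃ U, IsOpen[(plane k).top] U ∧ P ∈ U ∧ FiniteOver (iter F n) U}

end Plane

/-! ### The field of algebraic numbers, the height and the map -/

/-- The field of algebraic numbers. -/
abbrev Qbar := AlgebraicClosure ℚ

/-- The field generated by the chosen homogeneous coordinates of `P`. -/
abbrev coordField (P : P2 Qbar) : IntermediateField ℚ Qbar :=
  IntermediateField.adjoin ℚ (Set.range P.rep)

instance coordFieldNumberField (P : P2 Qbar) : NumberField (coordField P) where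
  to_charZero := inferInstance
  to_finiteDimensional :=
    IntermediateField.finiteDimensional_adjoin fun x _ =>
      isAlgebraic_iff_isIntegral.mp ((AlgebraicClosure.isAlgebraic ℚ).isAlgebraic x)

/-- The (absolute logarithmic) naive height on `ℙ²(ℚ̄)`: the logarithmic height relative to a number
field containing homogeneous coordinates of `P`, divided by the degree of that field. -/
def naiveHeight (P : P2 Qbar) : ℝ :=
  Height.logHeight (fun i => (⟨P.rep i, IntermediateField.subset_adjoin ℚ _ ⟨i, rfl⟩⟩ : coordField P))
    / Module.finrank ℚ (coordField P)

/-- The map `(x : y : z) ↦ (x^d - p^(-(d-3)) y²z^(d-2) : xy²z^(d-3) : y²z^(d-2))`, for `d ≥ 3`. -/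
def fMap (d p : ℕ) : Triple Qbar :=
  ![X 0 ^ d - C (1 / (p : Qbar) ^ (d - 3)) * X 1 ^ 2 * X 2 ^ (d - 2),
    X 0 * X 1 ^ 2 * X 2 ^ (d - 3),
    X 1 ^ 2 * X 2 ^ (d - 2)]

/-- The point `(a : b : 1)`. -/
def affinePoint (a b : Qbar) : P2 Qbar :=
  Projectivization.mk Qbar ![a, b, 1] fun h => one_ne_zero (congrFun h 2)

end UnbddPreper

end

/-!
In the affine coordinates `a = x / z`, `b = y / z` the map `f` is
`(a, b) ↦ (a ^ d / b ^ 2 - c, a)` with `c = 1 / p ^ (d - 3)`, so its orbits are the solutions of a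
recurrence of order two.

*Degrees.* The coordinates of each iterate have no common factor, which gives algebraic degree
`d ^ n`. The extension `k(ℙ²) / f^* k(ℙ²)` is generated by a square root of an element which is not
a square, which gives topological degree `2 ^ n`.

*Finiteness.* Going backwards, each step only extracts a square root, and `f ^ n` is finite over the
complement of the curve on which one of the divisors met on the way vanishes. If
`α ^ (d - 2) = α + c`, then `|α| < |c|` at a place above `p`, so by the ultrametric inequality all
the backward orbits of `(α, α)` have coordinates of absolute value `|α|` and avoid that curve.

*Density and heights.* For `d = 4` and `p = 2`, start with the preimages `(α, -α)` and `(-α, α)` and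
continue arbitrarily. At each place above `3` we have `(2 * α - 1) ^ 2 = 3`, so `|α| = 1` and
`|-α + 1 / 2| < 1`. From there on the logarithms of the absolute values of the coordinates satisfy
`e (n + 2) = 2 * e (n + 1) - e n / 2` and tend to infinity, hence so do the heights. As the dominant
root `1 + √2 / 2` is irrational, far along the orbit the terms of a given polynomial have distinct
absolute values, and the polynomial cannot vanish.
-/

noncomputable section

namespace UnbddPreper

/-! ### Iterates and the algebraic degree -/

section AlgebraicDegree

variable {k : Type*} [Field k]

lemma iter_succ (F : Triple k) (n : ℕ) (i : Fin 3) :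
    iter F (n + 1) i = bind₁ (iter F n) (F i) := rfl

lemma iter_one (F : Triple k) : iter F 1 = F :=
  funext fun i => by simp only [iter, bind₁_X_left, AlgHom.id_apply]

lemma eval_bind₁ {σ τ : Type*} (v : τ → k) (F : σ → MvPolynomial τ k) (Q : MvPolynomial σ k) :
    eval v (bind₁ F Q) = eval (fun i => eval v (F i)) Q := by
  simpa only [aeval_eq_eval] using aeval_bind₁ v F Q

lemma isHomogeneous_iter {F : Triple k} {e : ℕ} (hF : ∀ i, (F i).IsHomogeneous e) (n : ℕ)
    (i : Fin 3) : (iter F n i).IsHomogeneous (e ^ n) := by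
  induction n generalizing i with
  | zero => exact isHomogeneous_X _ _
  | succ n ih => exact pow_succ e n ▸ (hF i).aeval _ ih

lemma eval_iter_of_fixed {F : Triple k} {v : Fin 3 → k} (hv : ∀ i, eval v (F i) = v i) (n : ℕ)
    (i : Fin 3) : eval v (iter F n i) = v i := by
  induction n generalizing i with
  | zero => exact eval_X i
  | succ n ih => rw [iter_succ, eval_bind₁, funext ih, hv]

lemma represents_self {F : Triple k} {e : ℕ} (h0 : F ≠ 0) (hF : ∀ i, (F i).IsHomogeneous e) :
    Represents F F e :=
  ⟨h0, hF, fun _ _ => mul_comm _ _⟩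

lemma Represents.exists_eq_mul {F G : Triple k} {e : ℕ} (hG : Represents F G e) (h0 : F 0 ≠ 0)
    (hF : IsRelPrime (F 0) (F 1)) : ∃ q, ∀ i, G i = q * F i := by
  obtain ⟨-, -, hc⟩ := hG
  obtain ⟨q, hq⟩ : F 0 ∣ G 0 := hF.dvd_of_dvd_mul_left (Dvd.intro _ (hc 0 1))
  refine ⟨q, fun i => mul_left_cancel₀ h0 ?_⟩
  rw [hc 0 i, hq]
  ring

lemma algDegree_eq_of_isRelPrime {F : Triple k} {e : ℕ} (hF : ∀ i, (F i).IsHomogeneous e)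
    (h0 : F 0 ≠ 0) (h01 : IsRelPrime (F 0) (F 1)) : algDegree F = e := by
  have hself : Represents F F e := represents_self (fun h => h0 (congrFun h 0)) hF
  refine le_antisymm (Nat.sInf_le ⟨F, hself⟩) (le_csInf ⟨e, F, hself⟩ ?_)
  rintro e' ⟨G, hG⟩
  obtain ⟨q, hq⟩ := hG.exists_eq_mul h0 h01
  have hq0 : q ≠ 0 := by
    rintro rfl
    exact hG.1 (funext fun i => by rw [hq i, zero_mul, Pi.zero_apply])
  have hG0 : G 0 ≠ 0 := hq 0 ▸ mul_ne_zero hq0 h0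
  calc e = (F 0).totalDegree := ((hF 0).totalDegree h0).symm
    _ ≤ (G 0).totalDegree := by
      rw [hq 0, totalDegree_mul_of_isDomain hq0 h0]
      exact Nat.le_add_left _ _
    _ = e' := (hG.2.1 0).totalDegree hG0

lemma isRelPrime_pow_sub_of_dvd {R : Type*} [CommRing R] [DecompositionMonoid R] {a b t : R}
    (h : IsRelPrime a b) (hbt : b ∣ t) (n : ℕ) : IsRelPrime (a ^ n - t) b := fun _ hq hqb =>
  h.pow_left ((dvd_sub_left (hqb.trans hbt)).mp hq) hqb

lemma isRelPrime_pow_sub_self {R : Type*} [CommRing R] {a t : R} (h : IsRelPrime a t) {n : ℕ}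
    (hn : n ≠ 0) : IsRelPrime (a ^ n - t) a := fun _ hq hqa =>
  h hqa ((dvd_sub_right (dvd_pow hqa hn)).mp hq)

lemma isRelPrime_X_X {σ : Type*} {i j : σ} (h : i ≠ j) :
    IsRelPrime (X i : MvPolynomial σ k) (X j) := by
  rw [Irreducible.isRelPrime_iff_not_dvd (X_prime (R := k)).irreducible, X_dvd_X]
  simpa only [one_ne_zero, or_false] using h

end AlgebraicDegree

/-! ### Rational functions and the topological degree -/

section TopologicalDegree

lemma relfinrank_sup_adjoin_of_sq_mem {k L : Type*} [Field k] [Field L] [Algebra k L]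
    {E : IntermediateField k L} {v : L} (hv : v ∉ E) (hv2 : v ^ 2 ∈ E) :
    IntermediateField.relfinrank E (E ⊔ IntermediateField.adjoin k {v}) = 2 := by
  have hle : E ≤ E ⊔ IntermediateField.adjoin k {v} := le_sup_left
  have hext : IntermediateField.extendScalars hle = IntermediateField.adjoin E {v} :=
    IntermediateField.restrictScalars_injective k <| by
      rw [IntermediateField.restrictScalars_adjoin_eq_sup,
        IntermediateField.extendScalars_restrictScalars]
  let P : Polynomial E := Polynomial.X ^ 2 - Polynomial.C ⟨v ^ 2, hv2⟩
  have hroot : Polynomial.aeval v P = 0 := by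
    simp only [P, map_sub, map_pow, Polynomial.aeval_X, Polynomial.aeval_C]
    exact sub_self _
  have hmonic : P.Monic := Polynomial.monic_X_pow_sub_C _ two_ne_zero
  have hintegral : IsIntegral E v := ⟨P, hmonic, hroot⟩
  rw [IntermediateField.relfinrank_eq_finrank_of_le hle, hext,
    IntermediateField.adjoin.finrank hintegral]
  apply le_antisymm
  · calc (minpoly E v).natDegree ≤ P.natDegree :=
          Polynomial.natDegree_le_of_dvd (minpoly.dvd _ _ hroot) hmonic.ne_zero
      _ = 2 := Polynomial.natDegree_X_pow_sub_C
  · rw [minpoly.two_le_natDegree_iff hintegral]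
    rintro ⟨q, rfl⟩
    exact hv q.2

variable {k : Type*} [Field k]

variable (k) in
/-- The field of rational functions on affine 3-space, which contains the function field `k(ℙ²)`. -/
abbrev RatFun := FractionRing (MvPolynomial (Fin 3) k)

/-- The inclusion of the polynomials into the rational functions. -/
abbrev toRat : MvPolynomial (Fin 3) k →ₐ[k] RatFun k :=
  Algebra.algHom k (MvPolynomial (Fin 3) k) (RatFun k)

lemma toRat_injective : Function.Injective (toRat (k := k)) :=
  IsFractionRing.injective (MvPolynomial (Fin 3) k) (RatFun k)

lemma toRat_X_ne_zero (i : Fin 3) : toRat (X i : MvPolynomial (Fin 3) k) ≠ 0 :=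
  (map_ne_zero_iff toRat toRat_injective).mpr (X_ne_zero i)

/-- The substitution of `F` for the variables, as an endomorphism of the rational functions; it is
defined when no nonzero polynomial vanishes at `F`. -/
def substHom (F : Triple k) (hF : Function.Injective (bind₁ F)) : RatFun k →ₐ[k] RatFun k :=
  IsFractionRing.liftAlgHom (A := MvPolynomial (Fin 3) k) (g := toRat.comp (bind₁ F))
    (toRat_injective.comp hF)

variable {F : Triple k} {M : IntermediateField k (RatFun k)}

lemma substHom_toRat (hF : Function.Injective (bind₁ F)) (Q : MvPolynomial (Fin 3) k) :
    substHom F hF (toRat Q) = toRat (bind₁ F Q) :=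
  IsFractionRing.lift_algebraMap (A := MvPolynomial (Fin 3) k)
    (g := (toRat.comp (bind₁ F)).toRingHom) (toRat_injective.comp hF) Q

lemma substHom_pow_toRat (hF : Function.Injective (bind₁ F)) (n : ℕ)
    (Q : MvPolynomial (Fin 3) k) :
    (substHom F hF ^ n) (toRat Q) = toRat (bind₁ (iter F n) Q) := by
  induction n generalizing Q with
  | zero => simp only [pow_zero, AlgHom.one_apply, iter, bind₁_X_left, AlgHom.id_apply]
  | succ n ih =>
    rw [pow_succ, AlgHom.mul_apply, substHom_toRat, ih, bind₁_bind₁]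
    rfl

lemma toRat_div_mem_quotField (F : Triple k) (i j : Fin 3) :
    toRat (F i) / toRat (F j) ∈ quotField F :=
  IntermediateField.subset_adjoin _ _ ⟨i, j, rfl⟩

lemma quotField_le_iff {j : Fin 3} (hj : toRat (F j) ≠ 0) :
    quotField F ≤ M ↔ ∀ i, toRat (F i) / toRat (F j) ∈ M := by
  refine ⟨fun h i => h (toRat_div_mem_quotField F i j), fun h => ?_⟩
  rw [quotField, IntermediateField.adjoin_le_iff]
  rintro _ ⟨i, i', rfl⟩
  have := div_mem (h i) (h i')
  rwa [div_div_div_cancel_right₀ hj] at this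

lemma quotField_bind₁_iter (hF : Function.Injective (bind₁ F)) (G : Triple k) (n : ℕ) :
    quotField (fun i => bind₁ (iter F n) (G i)) = (quotField G).map (substHom F hF ^ n) := by
  have hsubst (i j : Fin 3) : (substHom F hF ^ n) (toRat (G i) / toRat (G j)) =
      toRat (bind₁ (iter F n) (G i)) / toRat (bind₁ (iter F n) (G j)) := by
    rw [map_div₀, substHom_pow_toRat, substHom_pow_toRat]
  rw [quotField, quotField, IntermediateField.adjoin_map]
  congr 1
  ext q
  constructor
  · rintro ⟨i, j, rfl⟩
    exact ⟨_, ⟨i, j, rfl⟩, hsubst i j⟩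
  · rintro ⟨_, ⟨i, j, rfl⟩, rfl⟩
    exact ⟨i, j, hsubst i j⟩

lemma quotField_iter (hF : Function.Injective (bind₁ F)) (n : ℕ) :
    quotField (iter F n) = (quotField X).map (substHom F hF ^ n) := by
  simpa only [bind₁_X_right] using quotField_bind₁_iter hF X n

lemma topDegree_iter (hF : Function.Injective (bind₁ F)) (hle : quotField F ≤ quotField X)
    (n : ℕ) : topDegree (iter F n) = topDegree F ^ n := by
  suffices h : topDegree (iter F n) = topDegree F ^ n ∧ quotField (iter F n) ≤ quotField X from h.1
  induction n with
  | zero => exact ⟨IntermediateField.relfinrank_self _, le_rfl⟩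
  | succ n ih =>
    have hsucc : quotField (iter F (n + 1)) = (quotField F).map (substHom F hF ^ n) :=
      quotField_bind₁_iter hF F n
    have hmono : quotField (iter F (n + 1)) ≤ quotField (iter F n) := by
      rw [hsucc, quotField_iter hF]
      exact IntermediateField.map_mono _ hle
    have hstep : IntermediateField.relfinrank (quotField (iter F (n + 1))) (quotField (iter F n)) =
        topDegree F := by
      rw [hsucc, quotField_iter hF, IntermediateField.relfinrank_map_map, topDegree]
    refine ⟨?_, hmono.trans ih.2⟩
    rw [topDegree, ← IntermediateField.relfinrank_mul_relfinrank hmono ih.2, hstep, ← topDegree,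
      ih.1, pow_succ']

lemma substHom_eq_self_of_mem_quotField {G : Triple k} (hG : Function.Injective (bind₁ G))
    (hGF : ∀ i, bind₁ G (F i) = F i) {q : RatFun k} (hq : q ∈ quotField F) :
    substHom G hG q = q := by
  induction hq using IntermediateField.adjoin_induction with
  | mem x hx =>
    obtain ⟨i, j, rfl⟩ := hx
    change substHom G hG (toRat (F i) / toRat (F j)) = toRat (F i) / toRat (F j)
    rw [map_div₀, substHom_toRat, substHom_toRat, hGF, hGF]
  | algebraMap x => exact AlgHom.commutes _ x
  | add x y _ _ hx hy => rw [map_add, hx, hy]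
  | inv x _ hx => rw [map_inv₀, hx]
  | mul x y _ _ hx hy => rw [map_mul, hx, hy]

end TopologicalDegree

/-! ### The degrees of the recurrence maps -/

section RecurrenceMap

variable {k : Type*} [Field k]

/-- The family of maps which contains `fMap`: in the affine coordinates `a = x / z` and `b = y / z`
it is `(a, b) ↦ (a ^ (m + 3) / b ^ 2 - c, a)`, so that its orbits are the solutions of a recurrence
of order two. The parameter `m` is `d - 3`, which avoids truncated subtraction. -/
def recurrenceMap (m : ℕ) (c : k) : Triple k :=
  ![X 0 ^ (m + 3) - C c * X 1 ^ 2 * X 2 ^ (m + 1), X 0 * X 1 ^ 2 * X 2 ^ m, X 1 ^ 2 * X 2 ^ (m + 1)]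

variable {m : ℕ} {c : k}

lemma bind₁_recurrenceMap (G : Triple k) : (fun i => bind₁ G (recurrenceMap m c i)) =
    ![G 0 ^ (m + 3) - C c * G 1 ^ 2 * G 2 ^ (m + 1), G 0 * G 1 ^ 2 * G 2 ^ m,
      G 1 ^ 2 * G 2 ^ (m + 1)] := by
  funext i
  fin_cases i <;> simp [recurrenceMap]

lemma eval_recurrenceMap (v : Fin 3 → k) : (fun i => eval v (recurrenceMap m c i)) =
    ![v 0 ^ (m + 3) - c * v 1 ^ 2 * v 2 ^ (m + 1), v 0 * v 1 ^ 2 * v 2 ^ m,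
      v 1 ^ 2 * v 2 ^ (m + 1)] := by
  funext i
  fin_cases i <;> simp [recurrenceMap]

lemma iter_recurrenceMap_succ (n : ℕ) : iter (recurrenceMap m c) (n + 1) =
    ![iter (recurrenceMap m c) n 0 ^ (m + 3) -
        C c * iter (recurrenceMap m c) n 1 ^ 2 * iter (recurrenceMap m c) n 2 ^ (m + 1),
      iter (recurrenceMap m c) n 0 * iter (recurrenceMap m c) n 1 ^ 2 *
        iter (recurrenceMap m c) n 2 ^ m,
      iter (recurrenceMap m c) n 1 ^ 2 * iter (recurrenceMap m c) n 2 ^ (m + 1)] :=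
  bind₁_recurrenceMap _

lemma isHomogeneous_recurrenceMap (i : Fin 3) : (recurrenceMap m c i).IsHomogeneous (m + 3) := by
  have h (i : Fin 3) : (X i : MvPolynomial (Fin 3) k).IsHomogeneous 1 := isHomogeneous_X k i
  fin_cases i
  · refine .sub (by simpa using (h 0).pow (m + 3)) ?_
    exact (by ring : 0 + 1 * 2 + 1 * (m + 1) = m + 3) ▸
      ((isHomogeneous_C _ c).mul ((h 1).pow 2)).mul ((h 2).pow (m + 1))
  · exact (by ring : 1 + 1 * 2 + 1 * m = m + 3) ▸ ((h 0).mul ((h 1).pow 2)).mul ((h 2).pow m)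
  · exact (by ring : 1 * 2 + 1 * (m + 1) = m + 3) ▸ ((h 1).pow 2).mul ((h 2).pow (m + 1))

lemma isHomogeneous_iter_recurrenceMap (n : ℕ) (i : Fin 3) :
    (iter (recurrenceMap m c) n i).IsHomogeneous ((m + 3) ^ n) :=
  isHomogeneous_iter isHomogeneous_recurrenceMap n i

lemma iter_recurrenceMap_zero_ne_zero (n : ℕ) : iter (recurrenceMap m c) n 0 ≠ 0 := fun h => by
  have hfix (i : Fin 3) :
      eval ![1, 0, 0] (recurrenceMap m c i) = (![1, 0, 0] : Fin 3 → k) i := by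
    rw [congrFun (eval_recurrenceMap ![1, 0, 0]) i]
    fin_cases i <;> simp
  simpa [h] using eval_iter_of_fixed hfix n 0

lemma represents_iter_recurrenceMap (n : ℕ) :
    Represents (iter (recurrenceMap m c) n) (iter (recurrenceMap m c) n) ((m + 3) ^ n) :=
  represents_self (fun h => iter_recurrenceMap_zero_ne_zero n (congrFun h 0))
    (isHomogeneous_iter_recurrenceMap n)

lemma represents_recurrenceMap :
    Represents (recurrenceMap m c) (recurrenceMap m c) (m + 3) := by
  simpa only [iter_one, pow_one] using represents_iter_recurrenceMap (m := m) (c := c) 1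

lemma isRelPrime_iter_recurrenceMap (hc : c ≠ 0) (n : ℕ) :
    IsRelPrime (iter (recurrenceMap m c) n 0) (iter (recurrenceMap m c) n 1) ∧
      IsRelPrime (iter (recurrenceMap m c) n 0) (iter (recurrenceMap m c) n 2) := by
  induction n with
  | zero => exact ⟨isRelPrime_X_X (by decide), isRelPrime_X_X (by decide)⟩
  | succ n ih =>
    obtain ⟨h1, h2⟩ := ih
    simp only [iter_recurrenceMap_succ, Matrix.cons_val]
    set A := iter (recurrenceMap m c) n 0
    set B := iter (recurrenceMap m c) n 1
    set D := iter (recurrenceMap m c) n 2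
    have hu : IsUnit (C c : MvPolynomial (Fin 3) k) := (isUnit_iff_ne_zero.mpr hc).map C
    set T := C c * B ^ 2 * D ^ (m + 1) with hT
    have hAT : IsRelPrime A T := (hu.isRelPrime_right.mul_right h1.pow_right).mul_right h2.pow_right
    have hA : IsRelPrime (A ^ (m + 3) - T) A := isRelPrime_pow_sub_self hAT (by omega)
    have hB : IsRelPrime (A ^ (m + 3) - T) B :=
      isRelPrime_pow_sub_of_dvd h1 ⟨C c * B * D ^ (m + 1), by rw [hT]; ring⟩ _
    have hD : IsRelPrime (A ^ (m + 3) - T) D :=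
      isRelPrime_pow_sub_of_dvd h2 ⟨C c * B ^ 2 * D ^ m, by rw [hT]; ring⟩ _
    exact ⟨(hA.mul_right hB.pow_right).mul_right hD.pow_right, hB.pow_right.mul_right hD.pow_right⟩

lemma algDegree_iter_recurrenceMap (hc : c ≠ 0) (n : ℕ) :
    algDegree (iter (recurrenceMap m c) n) = (m + 3) ^ n :=
  algDegree_eq_of_isRelPrime (isHomogeneous_iter_recurrenceMap n)
    (iter_recurrenceMap_zero_ne_zero n) (isRelPrime_iter_recurrenceMap hc n).1

lemma exists_eval_recurrenceMap_eq [IsAlgClosed k] {w : Fin 3 → k} (h0 : w 0 + c * w 2 ≠ 0)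
    (h1 : w 1 ≠ 0) (h2 : w 2 ≠ 0) :
    ∃ v : Fin 3 → k, (fun i => eval v (recurrenceMap m c i)) = w := by
  obtain ⟨x, hx⟩ := IsAlgClosed.exists_pow_nat_eq (w 0 + c * w 2) (show 0 < m + 3 by omega)
  have hx0 : x ≠ 0 := by
    rintro rfl
    exact h0 (by rw [← hx, zero_pow (by omega)])
  obtain ⟨z, hz⟩ : ∃ z, z = x * w 2 / w 1 := ⟨_, rfl⟩
  have hz0 : z ≠ 0 := hz ▸ div_ne_zero (mul_ne_zero hx0 h2) h1
  obtain ⟨y, hy⟩ := IsAlgClosed.exists_pow_nat_eq (w 2 / z ^ (m + 1)) two_pos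
  have hyz : y ^ 2 * z ^ (m + 1) = w 2 := by rw [hy, div_mul_cancel₀ _ (pow_ne_zero _ hz0)]
  refine ⟨![x, y, z], ?_⟩
  rw [eval_recurrenceMap]
  funext i
  fin_cases i
  · change x ^ (m + 3) - c * y ^ 2 * z ^ (m + 1) = w 0
    linear_combination hx - c * hyz
  · change x * y ^ 2 * z ^ m = w 1
    refine mul_right_cancel₀ hz0 ?_
    calc x * y ^ 2 * z ^ m * z = x * w 2 := by rw [← hyz]; ring
      _ = w 1 * z := by rw [hz, mul_div_cancel₀ _ h1]
  · exact hyz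

lemma bind₁_recurrenceMap_injective [IsAlgClosed k] :
    Function.Injective (bind₁ (recurrenceMap m c)) := by
  rw [injective_iff_map_eq_zero]
  intro Q hQ
  -- By `exists_eval_recurrenceMap_eq`, the values of the map fill the complement of `L = 0`.
  let L : MvPolynomial (Fin 3) k := (X 0 + C c * X 2) * X 1 * X 2
  have hL : L ≠ 0 := fun h => by
    simpa [L] using congrArg (eval ![1 - c, 1, 1]) h
  have hLQ : L * Q = 0 := by
    refine MvPolynomial.funext fun w => ?_
    rw [map_mul, map_zero, mul_eq_zero]
    by_contra! hw
    obtain ⟨hwL, hwQ⟩ := hw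
    simp only [L, map_mul, map_add, eval_X, eval_C, ne_eq, mul_eq_zero, not_or] at hwL
    obtain ⟨v, rfl⟩ := exists_eval_recurrenceMap_eq (m := m) hwL.1.1 hwL.1.2 hwL.2
    rw [← eval_bind₁, hQ, map_zero] at hwQ
    exact hwQ rfl
  exact (mul_eq_zero.mp hLQ).resolve_left hL

/-- The change of sign of the second coordinate, which generates the Galois group of the extension
of function fields defined by `recurrenceMap`. -/
def negSecond : Triple k := ![X 0, -X 1, X 2]

lemma bind₁_negSecond_injective : Function.Injective (bind₁ (negSecond (k := k))) := by
  have hinvol : (fun i => bind₁ negSecond (negSecond (k := k) i)) = X := by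
    funext i
    fin_cases i <;> simp [negSecond]
  have : Function.LeftInverse (bind₁ (negSecond (k := k))) (bind₁ negSecond) := fun Q => by
    rw [bind₁_bind₁, hinvol, bind₁_X_left, AlgHom.id_apply]
  exact this.injective

lemma bind₁_negSecond_recurrenceMap (i : Fin 3) :
    bind₁ negSecond (recurrenceMap m c i) = recurrenceMap m c i := by
  rw [congrFun (bind₁_recurrenceMap negSecond) i]
  simp only [negSecond, Matrix.cons_val, neg_sq, recurrenceMap]

lemma toRat_second_notMem_quotField_recurrenceMap [NeZero (2 : k)] :
    toRat (X 1) / toRat (X 2) ∉ quotField (recurrenceMap m c) := fun h => by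
  have hfix := substHom_eq_self_of_mem_quotField bind₁_negSecond_injective
    bind₁_negSecond_recurrenceMap h
  rw [map_div₀, substHom_toRat, substHom_toRat, bind₁_X_right, bind₁_X_right] at hfix
  simp only [negSecond, Matrix.cons_val, map_neg] at hfix
  have h1 := toRat_X_ne_zero (k := k) 1
  have h2 := toRat_X_ne_zero (k := k) 2
  have htwo : (2 : RatFun k) ≠ 0 := by
    simpa only [map_ofNat] using (map_ne_zero (algebraMap k (RatFun k))).mpr (two_ne_zero (α := k))
  field_simp at hfix
  exact htwo (by linear_combination -hfix)

lemma toRat_recurrenceMap_two_ne_zero : toRat (recurrenceMap m c 2) ≠ 0 := by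
  change toRat (X 1 ^ 2 * X 2 ^ (m + 1)) ≠ 0
  rw [map_mul, map_pow, map_pow]
  exact mul_ne_zero (pow_ne_zero _ (toRat_X_ne_zero 1)) (pow_ne_zero _ (toRat_X_ne_zero 2))

lemma toRat_recurrenceMap_zero_div_two :
    toRat (recurrenceMap m c 0) / toRat (recurrenceMap m c 2) =
      (toRat (X 0) / toRat (X 2)) ^ (m + 3) / (toRat (X 1) / toRat (X 2)) ^ 2 -
        algebraMap k (RatFun k) c := by
  have h1 := toRat_X_ne_zero (k := k) 1
  have h2 := toRat_X_ne_zero (k := k) 2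
  simp only [recurrenceMap, Matrix.cons_val, map_sub, map_mul, map_pow, ← algebraMap_eq,
    AlgHom.commutes, div_pow]
  field_simp
  ring

lemma toRat_recurrenceMap_one_div_two :
    toRat (recurrenceMap m c 1) / toRat (recurrenceMap m c 2) = toRat (X 0) / toRat (X 2) := by
  have h1 := toRat_X_ne_zero (k := k) 1
  have h2 := toRat_X_ne_zero (k := k) 2
  simp only [recurrenceMap, Matrix.cons_val, map_mul, map_pow]
  field_simp
  ring

lemma quotField_recurrenceMap_le : quotField (recurrenceMap m c) ≤ quotField X := by
  have ha := toRat_div_mem_quotField (k := k) X 0 2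
  have hb := toRat_div_mem_quotField (k := k) X 1 2
  refine (quotField_le_iff toRat_recurrenceMap_two_ne_zero).mpr fun i => ?_
  fin_cases i
  · exact toRat_recurrenceMap_zero_div_two (m := m) (c := c) ▸
      sub_mem (div_mem (pow_mem ha _) (pow_mem hb _)) (IntermediateField.algebraMap_mem _ _)
  · exact toRat_recurrenceMap_one_div_two (m := m) (c := c) ▸ ha
  · exact div_self (toRat_recurrenceMap_two_ne_zero (m := m) (c := c)) ▸ one_mem _

lemma toRat_first_mem_quotField_recurrenceMap :
    toRat (X 0) / toRat (X 2) ∈ quotField (recurrenceMap m c) :=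
  toRat_recurrenceMap_one_div_two (m := m) (c := c) ▸ toRat_div_mem_quotField _ 1 2

lemma toRat_second_sq_mem_quotField_recurrenceMap :
    (toRat (X 1) / toRat (X 2)) ^ 2 ∈ quotField (recurrenceMap m c) := by
  have h0 := div_ne_zero (toRat_X_ne_zero (k := k) 0) (toRat_X_ne_zero (k := k) 2)
  have hsq : (toRat (X 1) / toRat (X 2)) ^ 2 = (toRat (X 0) / toRat (X 2)) ^ (m + 3) /
      (toRat (recurrenceMap m c 0) / toRat (recurrenceMap m c 2) + algebraMap k (RatFun k) c) := by
    rw [toRat_recurrenceMap_zero_div_two, sub_add_cancel, div_div_cancel₀ (pow_ne_zero _ h0)]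
  rw [hsq]
  exact div_mem (pow_mem toRat_first_mem_quotField_recurrenceMap _)
    (add_mem (toRat_div_mem_quotField _ _ _) (IntermediateField.algebraMap_mem _ _))

lemma quotField_X_eq_sup_adjoin : quotField X = quotField (recurrenceMap m c) ⊔
    IntermediateField.adjoin k {toRat (X 1) / toRat (X 2)} := by
  refine le_antisymm ((quotField_le_iff (toRat_X_ne_zero 2)).mpr fun i => ?_)
    (sup_le quotField_recurrenceMap_le (IntermediateField.adjoin_simple_le_iff.mpr
      (toRat_div_mem_quotField X 1 2)))
  fin_cases i
  · exact (le_sup_left : quotField (recurrenceMap m c) ≤ _) toRat_first_mem_quotField_recurrenceMap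
  · exact (le_sup_right : IntermediateField.adjoin k _ ≤ _)
      (IntermediateField.mem_adjoin_simple_self k _)
  · exact div_self (toRat_X_ne_zero (k := k) 2) ▸ one_mem _

lemma topDegree_recurrenceMap [NeZero (2 : k)] : topDegree (recurrenceMap m c) = 2 := by
  rw [topDegree, quotField_X_eq_sup_adjoin (m := m) (c := c)]
  exact relfinrank_sup_adjoin_of_sq_mem toRat_second_notMem_quotField_recurrenceMap
    toRat_second_sq_mem_quotField_recurrenceMap

lemma hasDynDegree_of_degreeOf_iter_eq_pow {F : Triple k} {i a : ℕ}
    (h : ∀ n, degreeOf (iter F n) i = a ^ n) : HasDynDegree F i a := by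
  refine tendsto_const_nhds.congr' ?_
  filter_upwards [eventually_ge_atTop 1] with n hn
  rw [h, Nat.cast_pow, one_div, Real.pow_rpow_inv_natCast (Nat.cast_nonneg _) (by omega)]

lemma hasDynDegree_recurrenceMap_one (hc : c ≠ 0) :
    HasDynDegree (recurrenceMap m c) 1 (m + 3 : ℕ) :=
  hasDynDegree_of_degreeOf_iter_eq_pow fun n => algDegree_iter_recurrenceMap hc n

lemma hasDynDegree_recurrenceMap_two [IsAlgClosed k] [NeZero (2 : k)] :
    HasDynDegree (recurrenceMap m c) 2 2 := by
  refine mod_cast hasDynDegree_of_degreeOf_iter_eq_pow (a := 2) fun n => ?_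
  rw [degreeOf, topDegree_iter bind₁_recurrenceMap_injective quotField_recurrenceMap_le,
    topDegree_recurrenceMap]

end RecurrenceMap

/-! ### Regular functions and morphisms -/

section Regular

variable {k X Y Z : Type*} {𝒳 : Basics k X} {𝒴 : Basics k Y} {𝒵 : Basics k Z}
  {S : Set X} {T : Set Y} {φ ψ : X → k}

lemma Basics.RegularOn.mono {S' : Set X} (h : 𝒳.RegularOn S φ) (hS : S' ⊆ S) :
    𝒳.RegularOn S' φ := fun x hx => by
  obtain ⟨D, ψ, hD, hxD, hψ⟩ := h x (hS hx)
  exact ⟨D, ψ, hD, hxD, fun y hy => hψ y ⟨hS hy.1, hy.2⟩⟩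

lemma Basics.RegularOn.congr (h : 𝒳.RegularOn S φ) (he : Set.EqOn ψ φ S) :
    𝒳.RegularOn S ψ := fun x hx => by
  obtain ⟨D, χ, hD, hxD, hχ⟩ := h x hx
  exact ⟨D, χ, hD, hxD, fun y hy => (he hy.1).trans (hχ y hy)⟩

lemma Basics.isOpen_of_mem {D : Set X} (h : (D, ψ) ∈ 𝒳) : IsOpen[𝒳.top] D :=
  TopologicalSpace.GenerateOpen.basic _ ⟨ψ, h⟩

lemma IsMorphism.mono {u : X → Y} {S' : Set X} {T' : Set Y} (h : IsMorphism 𝒳 𝒴 u S T)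
    (hS : S' ⊆ S) (hu : Set.MapsTo u S' T') : IsMorphism 𝒳 𝒴 u S' T' := by
  refine ⟨hu, fun D ψ hD => ⟨?_, (h.2 D ψ hD).2.mono (Set.inter_subset_inter_left _ hS)⟩⟩
  obtain ⟨O, hO, he⟩ := (h.2 D ψ hD).1
  refine ⟨O, hO, ?_⟩
  rw [← Set.inter_eq_left.mpr hS, Set.inter_assoc, he, Set.inter_assoc]

lemma isMorphism_of_forall_comp_mem {u : X → Y} (hu : Set.MapsTo u S T)
    (h : ∀ D ψ, (D, ψ) ∈ 𝒴 → (u ⁻¹' D, ψ ∘ u) ∈ 𝒳) : IsMorphism 𝒳 𝒴 u S T :=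
  ⟨hu, fun D ψ hD => ⟨⟨_, Basics.isOpen_of_mem (h D ψ hD), rfl⟩,
    fun _ hx => ⟨_, _, h D ψ hD, hx.2, fun _ _ => rfl⟩⟩⟩

lemma IsMorphism.openIn_preimage {u : X → Y} (h : IsMorphism 𝒳 𝒴 u S T) {O : Set Y}
    (hO : IsOpen[𝒴.top] O) : 𝒳.OpenIn S (S ∩ u ⁻¹' O) := by
  induction hO with
  | basic D hD => exact (h.2 D _ hD.choose_spec).1
  | univ => exact ⟨_, @isOpen_univ _ 𝒳.top, rfl⟩
  | inter A B _ _ hA hB =>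
    obtain ⟨U, hU, hAU⟩ := hA
    obtain ⟨V, hV, hBV⟩ := hB
    refine ⟨U ∩ V, @IsOpen.inter _ 𝒳.top _ _ hU hV, ?_⟩
    rw [Set.preimage_inter, Set.inter_inter_distrib_left, hAU, hBV, ← Set.inter_inter_distrib_left]
  | sUnion 𝒮 _ ih =>
    choose! U hU hSU using ih
    refine ⟨⋃ A ∈ 𝒮, U A, @isOpen_biUnion _ _ 𝒳.top _ _ hU, ?_⟩
    rw [Set.preimage_sUnion, Set.inter_iUnion₂, Set.inter_iUnion₂]
    exact Set.iUnion₂_congr hSU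

variable [Field k]

/-- The basic regular functions are stable under the arithmetic of fractions, each operation being
performed on a basic open set on which it makes sense. -/
class Basics.IsFractional (𝒳 : Basics k X) : Prop where
  const_mem (c : k) : (Set.univ, fun _ => c) ∈ 𝒳
  mul_mem {D D' : Set X} {ψ ψ' : X → k} : (D, ψ) ∈ 𝒳 → (D', ψ') ∈ 𝒳 → (D ∩ D', ψ * ψ') ∈ 𝒳
  add_mem {D D' : Set X} {ψ ψ' : X → k} : (D, ψ) ∈ 𝒳 → (D', ψ') ∈ 𝒳 →
    ∃ χ, (D ∩ D', χ) ∈ 𝒳 ∧ Set.EqOn χ (ψ + ψ') (D ∩ D')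
  inv_mem {D : Set X} {ψ : X → k} : (D, ψ) ∈ 𝒳 → (D ∩ {x | ψ x ≠ 0}, ψ⁻¹) ∈ 𝒳

/-- The basic regular functions that are quotients of weighted homogeneous polynomials of the same
weight, evaluated at chosen coordinates `ρ`. -/
def gradedBasics {σ M : Type*} [AddCommMonoid M] (w : σ → M) (ρ : X → σ → k) : Basics k X :=
  {q | ∃ (e : M) (A B : MvPolynomial σ k),
    A.IsWeightedHomogeneous w e ∧ B.IsWeightedHomogeneous w e ∧
    q = ({x | eval (ρ x) B ≠ 0}, fun x => eval (ρ x) A / eval (ρ x) B)}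

instance {σ M : Type*} [AddCommMonoid M] (w : σ → M) (ρ : X → σ → k) :
    (gradedBasics w ρ).IsFractional where
  const_mem c := ⟨0, C c, 1, isWeightedHomogeneous_C w c, isWeightedHomogeneous_one k w, by simp⟩
  mul_mem := by
    rintro _ _ _ _ ⟨e, A, B, hA, hB, rfl, rfl⟩ ⟨e', A', B', hA', hB', rfl, rfl⟩
    refine ⟨e + e', A * A', B * B', hA.mul hA', hB.mul hB', Prod.ext ?_ ?_⟩
    · ext x
      simp
    · ext x
      simp [div_mul_div_comm]
  add_mem := by
    rintro _ _ _ _ ⟨e, A, B, hA, hB, rfl, rfl⟩ ⟨e', A', B', hA', hB', rfl, rfl⟩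
    refine ⟨_, ⟨e + e', A * B' + B * A', B * B', (hA.mul hB').add (hB.mul hA'), hB.mul hB',
      Prod.ext ?_ rfl⟩, fun x hx => ?_⟩
    · ext x
      simp
    · simp [div_add_div _ _ hx.1 hx.2]
  inv_mem := by
    rintro _ _ ⟨e, A, B, hA, hB, rfl, rfl⟩
    refine ⟨e + e, B * B, A * B, hB.mul hB, hA.mul hB, Prod.ext ?_ ?_⟩
    · ext x
      simp +contextual
    · ext x
      by_cases hx : eval (ρ x) B = 0 <;> simp [hx, mul_div_mul_right]

lemma affineSpace_eq_gradedBasics (m : ℕ) :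
    affineSpace k m = gradedBasics (fun _ => PUnit.unit) id :=
  Set.ext fun _ => ⟨fun ⟨A, B, h⟩ => ⟨PUnit.unit, A, B, fun _ _ => rfl, fun _ _ => rfl, h⟩,
    fun ⟨_, A, B, _, _, h⟩ => ⟨A, B, h⟩⟩

instance (m : ℕ) : (affineSpace k m).IsFractional :=
  affineSpace_eq_gradedBasics (k := k) m ▸ inferInstance

section Fractional

variable [𝒳.IsFractional]

lemma Basics.exists_restrict_mem {D D' : Set X} {ψ' : X → k} (h : (D, ψ) ∈ 𝒳)
    (h' : (D', ψ') ∈ 𝒳) : ∃ χ, (D ∩ D', χ) ∈ 𝒳 ∧ Set.EqOn χ ψ (D ∩ D') := by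
  obtain ⟨χ, hχ, he⟩ := IsFractional.add_mem h (IsFractional.mul_mem (IsFractional.const_mem 0) h')
  rw [Set.univ_inter] at hχ he
  exact ⟨χ, hχ, fun x hx => by simpa using he hx⟩

lemma Basics.exists_mem_subset_of_isOpen {O : Set X} (hO : IsOpen[𝒳.top] O) {x : X} (hx : x ∈ O) :
    ∃ D ψ, (D, ψ) ∈ 𝒳 ∧ x ∈ D ∧ D ⊆ O := by
  induction hO with
  | basic D hD => exact ⟨D, _, hD.choose_spec, hx, subset_rfl⟩
  | univ => exact ⟨_, _, IsFractional.const_mem 0, trivial, subset_rfl⟩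
  | inter _ _ _ _ hA hB =>
    obtain ⟨D, ψ, hD, hxD, hDA⟩ := hA hx.1
    obtain ⟨D', ψ', hD', hxD', hDB⟩ := hB hx.2
    exact ⟨_, _, IsFractional.mul_mem hD hD', ⟨hxD, hxD'⟩, Set.inter_subset_inter hDA hDB⟩
  | sUnion 𝒮 _ ih =>
    obtain ⟨A, hA, hxA⟩ := hx
    obtain ⟨D, ψ, hD, hxD, hDA⟩ := ih A hA hxA
    exact ⟨D, ψ, hD, hxD, hDA.trans (Set.subset_sUnion_of_mem hA)⟩

lemma Basics.regularOn_of_local (h : ∀ x ∈ S, ∃ T, 𝒳.OpenIn S T ∧ x ∈ T ∧ 𝒳.RegularOn T φ) :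
    𝒳.RegularOn S φ := fun x hx => by
  obtain ⟨_, ⟨O, hO, rfl⟩, hxO, hφ⟩ := h x hx
  obtain ⟨D, ψ, hD, hxD, hDO⟩ := exists_mem_subset_of_isOpen hO hxO.2
  obtain ⟨D', ψ', hD', hxD', he⟩ := hφ x hxO
  obtain ⟨χ, hχ, hχψ⟩ := exists_restrict_mem hD' hD
  exact ⟨_, _, hχ, ⟨hxD', hxD⟩, fun y hy =>
    (he y ⟨⟨hy.1, hDO hy.2.2⟩, hy.2.1⟩).trans (hχψ hy.2).symm⟩

variable (𝒳 S) in
/-- The algebra of functions that are regular on `S` (with arbitrary values outside `S`). -/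
def Basics.regularAlgebra : Subalgebra k (X → k) where
  carrier := {φ | 𝒳.RegularOn S φ}
  mul_mem' := fun hφ hψ x hx => by
    obtain ⟨D, χ, hD, hxD, he⟩ := hφ x hx
    obtain ⟨D', χ', hD', hxD', he'⟩ := hψ x hx
    refine ⟨_, _, IsFractional.mul_mem hD hD', ⟨hxD, hxD'⟩, fun y hy => ?_⟩
    rw [Pi.mul_apply, Pi.mul_apply, he y ⟨hy.1, hy.2.1⟩, he' y ⟨hy.1, hy.2.2⟩]
  add_mem' := fun hφ hψ x hx => by
    obtain ⟨D, χ, hD, hxD, he⟩ := hφ x hx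
    obtain ⟨D', χ', hD', hxD', he'⟩ := hψ x hx
    obtain ⟨θ, hθ, hθe⟩ := IsFractional.add_mem hD hD'
    refine ⟨_, _, hθ, ⟨hxD, hxD'⟩, fun y hy => ?_⟩
    rw [hθe hy.2, Pi.add_apply, Pi.add_apply, he y ⟨hy.1, hy.2.1⟩, he' y ⟨hy.1, hy.2.2⟩]
  algebraMap_mem' c _ _ := ⟨_, _, IsFractional.const_mem c, trivial, fun _ _ => rfl⟩

lemma eval_mem_of_forall_mem {σ : Type*} {B : Subalgebra k (X → k)} {t : X → σ → k}
    (ht : ∀ i, (fun x => t x i) ∈ B) (Q : MvPolynomial σ k) : (fun x => eval (t x) Q) ∈ B := by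
  induction Q using MvPolynomial.induction_on with
  | C a =>
    simp only [eval_C]
    exact B.algebraMap_mem a
  | add p q hp hq =>
    simp only [map_add]
    exact B.add_mem hp hq
  | mul_X p i hp =>
    simp only [map_mul, eval_X]
    exact B.mul_mem hp (ht i)

lemma Basics.RegularOn.eval {σ : Type*} {t : X → σ → k}
    (ht : ∀ i, 𝒳.RegularOn S fun x => t x i) (Q : MvPolynomial σ k) :
    𝒳.RegularOn S fun x => MvPolynomial.eval (t x) Q :=
  eval_mem_of_forall_mem (B := 𝒳.regularAlgebra S) ht Q

lemma Basics.RegularOn.inv (hφ : 𝒳.RegularOn S φ) (h0 : ∀ x ∈ S, φ x ≠ 0) :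
    𝒳.RegularOn S fun x => (φ x)⁻¹ := fun x hx => by
  obtain ⟨D, χ, hD, hxD, he⟩ := hφ x hx
  have hx0 : χ x ≠ 0 := he x ⟨hx, hxD⟩ ▸ h0 x hx
  exact ⟨_, _, IsFractional.inv_mem hD, ⟨hxD, hx0⟩,
    fun y hy => congrArg _ (he y ⟨hy.1, hy.2.1⟩)⟩

lemma Basics.RegularOn.div (hφ : 𝒳.RegularOn S φ) (hψ : 𝒳.RegularOn S ψ)
    (h0 : ∀ x ∈ S, ψ x ≠ 0) : 𝒳.RegularOn S fun x => φ x / ψ x := by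
  simp only [div_eq_mul_inv]
  exact (𝒳.regularAlgebra S).mul_mem hφ (hψ.inv h0)

lemma Basics.RegularOn.openIn_ne_zero (hφ : 𝒳.RegularOn S φ) :
    𝒳.OpenIn S (S ∩ {x | φ x ≠ 0}) := by
  refine ⟨⋃₀ {O | IsOpen[𝒳.top] O ∧ ∀ x ∈ S ∩ O, φ x ≠ 0},
    @isOpen_sUnion _ 𝒳.top _ fun O hO => hO.1, Set.ext fun x => and_congr_right fun hx => ?_⟩
  refine ⟨fun hφx => ?_, fun ⟨O, hO, hxO⟩ => hO.2 x ⟨hx, hxO⟩⟩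
  obtain ⟨D, χ, hD, hxD, he⟩ := hφ x hx
  have hχx : χ x ≠ 0 := he x ⟨hx, hxD⟩ ▸ hφx
  exact ⟨_, ⟨isOpen_of_mem (IsFractional.inv_mem hD), fun y hy => he y ⟨hy.1, hy.2.1⟩ ▸ hy.2.2⟩,
    hxD, hχx⟩

lemma isMorphism_of_forall_quotient {u : X → Y} (hu : Set.MapsTo u S T)
    (h : ∀ D ψ, (D, ψ) ∈ 𝒴 → ∃ A B, 𝒳.RegularOn S A ∧ 𝒳.RegularOn S B ∧
      ∀ x ∈ S, (u x ∈ D ↔ B x ≠ 0) ∧ (u x ∈ D → ψ (u x) = A x / B x)) :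
    IsMorphism 𝒳 𝒴 u S T := by
  refine ⟨hu, fun D ψ hD => ?_⟩
  obtain ⟨A, B, hA, hB, hAB⟩ := h D ψ hD
  have hS : S ∩ u ⁻¹' D = S ∩ {x | B x ≠ 0} :=
    Set.ext fun x => and_congr_right fun hx => (hAB x hx).1
  rw [hS]
  refine ⟨hB.openIn_ne_zero, ((hA.mono Set.inter_subset_left).div (hB.mono Set.inter_subset_left)
    fun x hx => hx.2).congr fun x hx => (hAB x hx.1).2 ((hAB x hx.1).1.mpr hx.2)⟩

lemma eval_mul_of_isWeightedHomogeneous {σ M : Type*} [AddCommMonoid M] {w : σ → M}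
    {A : MvPolynomial σ k} {e : M} (hA : A.IsWeightedHomogeneous w e) (χ : Multiplicative M →* k)
    (v : σ → k) :
    eval (fun i => χ (Multiplicative.ofAdd (w i)) * v i) A =
      χ (Multiplicative.ofAdd e) * eval v A := by
  have hχ (m : σ →₀ ℕ) : (m.prod fun i j => χ (Multiplicative.ofAdd (w i)) ^ j) =
      χ (Multiplicative.ofAdd (Finsupp.weight w m)) := by
    induction m using Finsupp.induction_linear with
    | zero => simp
    | add f g hf hg =>
      rw [Finsupp.prod_add_index' (by simp) (by simp [pow_add]), hf, hg, map_add, ofAdd_add,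
        map_mul]
    | single i j => simp [Finsupp.weight_apply, ofAdd_nsmul]
  rw [eval_eq, eval_eq, Finset.mul_sum]
  refine Finset.sum_congr rfl fun m hm => ?_
  rw [← hA (mem_support_iff.mp hm), ← hχ m, Finsupp.prod]
  simp only [mul_pow, Finset.prod_mul_distrib]
  ring

lemma isMorphism_gradedBasics {σ M : Type*} [AddCommMonoid M] {w : σ → M} {ρ : Y → σ → k}
    {u : X → Y} (hu : Set.MapsTo u S T) {t : X → σ → k}
    (ht : ∀ i, 𝒳.RegularOn S fun x => t x i)
    (h : ∀ x ∈ S, ∃ χ : Multiplicative M →* k, (∀ m, χ m ≠ 0) ∧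
      ∀ i, ρ (u x) i = χ (Multiplicative.ofAdd (w i)) * t x i) :
    IsMorphism 𝒳 (gradedBasics w ρ) u S T := by
  refine isMorphism_of_forall_quotient hu ?_
  rintro _ _ ⟨e, A, B, hA, hB, rfl, rfl⟩
  refine ⟨_, _, .eval ht A, .eval ht B, fun x hx => ?_⟩
  obtain ⟨χ, hχ, hρ⟩ := h x hx
  simp only [Set.mem_ofPred_eq, funext hρ, eval_mul_of_isWeightedHomogeneous hA,
    eval_mul_of_isWeightedHomogeneous hB]
  exact ⟨by simp [hχ], fun _ => mul_div_mul_left _ _ (hχ _)⟩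

lemma isMorphism_affineSpace {m : ℕ} {u : X → Fin m → k} {T : Set (Fin m → k)}
    (hu : Set.MapsTo u S T) (hreg : ∀ i, 𝒳.RegularOn S fun x => u x i) :
    IsMorphism 𝒳 (affineSpace k m) u S T :=
  affineSpace_eq_gradedBasics (k := k) m ▸
    isMorphism_gradedBasics hu hreg fun _ _ => ⟨1, fun _ => one_ne_zero, by simp⟩

lemma IsMorphism.comp_regularOn {u : X → Y} (hu : IsMorphism 𝒳 𝒴 u S T) {φ : Y → k}
    (hφ : 𝒴.RegularOn T φ) : 𝒳.RegularOn S (φ ∘ u) := by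
  refine Basics.regularOn_of_local fun x hx => ?_
  obtain ⟨D, ψ, hD, hxD, he⟩ := hφ (u x) (hu.1 hx)
  exact ⟨_, (hu.2 D ψ hD).1, ⟨hx, hxD⟩,
    (hu.2 D ψ hD).2.congr fun y hy => he (u y) ⟨hu.1 hy.1, hy.2⟩⟩

lemma IsMorphism.comp {u : X → Y} {v : Y → Z} {W : Set Z} (hv : IsMorphism 𝒴 𝒵 v T W)
    (hu : IsMorphism 𝒳 𝒴 u S T) : IsMorphism 𝒳 𝒵 (v ∘ u) S W := by
  refine ⟨hv.1.comp hu.1, fun D ψ hD => ⟨?_, ?_⟩⟩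
  · obtain ⟨O, hO, he⟩ := (hv.2 D ψ hD).1
    have : S ∩ v ∘ u ⁻¹' D = S ∩ u ⁻¹' O := Set.ext fun x => and_congr_right fun hx =>
      by simpa [hu.1 hx] using Set.ext_iff.mp he (u x)
    rw [this]
    exact hu.openIn_preimage hO
  · exact (hu.mono (T' := T ∩ v ⁻¹' D) Set.inter_subset_left
      fun x hx => ⟨hu.1 hx.1, hx.2⟩).comp_regularOn (hv.2 D ψ hD).2

end Fractional

lemma Basics.regularOn_coord {m : ℕ} (T : Set (Fin m → k)) (i : Fin m) :
    (affineSpace k m).RegularOn T fun x => x i := fun _ _ =>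
  ⟨_, _, ⟨X i, 1, rfl⟩, by simp, fun _ _ => by simp⟩

lemma IsMorphism.regularOn_coord [𝒳.IsFractional] {m : ℕ} {u : X → Fin m → k}
    {T : Set (Fin m → k)} (hu : IsMorphism 𝒳 (affineSpace k m) u S T) (i : Fin m) :
    𝒳.RegularOn S fun x => u x i :=
  hu.comp_regularOn (Basics.regularOn_coord T i)

end Regular

section PrincipalOpen

variable {k : Type*} [Field k] {m : ℕ}

/-- The principal open subset `D(H)` of affine space. -/
def principalOpen (H : MvPolynomial (Fin m) k) : Set (Fin m → k) := {z | eval z H ≠ 0}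

/-- The denominators of `φ` on `D(H)`. -/
def denominatorIdeal (H : MvPolynomial (Fin m) k) (φ : (Fin m → k) → k) :
    Ideal (MvPolynomial (Fin m) k) where
  carrier := {b | ∃ a, ∀ z ∈ principalOpen H, eval z b * φ z = eval z a}
  add_mem' := by
    rintro b b' ⟨a, ha⟩ ⟨a', ha'⟩
    exact ⟨a + a', fun z hz => by rw [map_add, map_add, add_mul, ha z hz, ha' z hz]⟩
  zero_mem' := ⟨0, fun z _ => by simp⟩
  smul_mem' := by
    rintro c b ⟨a, ha⟩
    exact ⟨c * a, fun z hz => by rw [smul_eq_mul, map_mul, map_mul, mul_assoc, ha z hz]⟩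

lemma eval_eq_zero_of_mem_zeroLocus_denominatorIdeal {H : MvPolynomial (Fin m) k}
    {φ : (Fin m → k) → k} (hφ : (affineSpace k m).RegularOn (principalOpen H) φ) {z : Fin m → k}
    (hz : z ∈ zeroLocus k (denominatorIdeal H φ)) : eval z H = 0 := by
  by_contra hzH
  obtain ⟨_, _, ⟨A, B, rfl, rfl⟩, hzB, he⟩ := hφ z hzH
  have hB : B * B ∈ denominatorIdeal H φ := ⟨A * B, fun y hy => by
    by_cases hyB : eval y B = 0
    · simp [hyB]
    · rw [he y ⟨hy, hyB⟩, map_mul, map_mul]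
      field_simp⟩
  exact hzB (by simpa using hz _ hB)

-- Nullstellensatz: the denominators of `φ` have no common zero in `D(H)`.
lemma exists_pow_mul_eq_eval [IsAlgClosed k] {H : MvPolynomial (Fin m) k} {φ : (Fin m → k) → k}
    (hφ : (affineSpace k m).RegularOn (principalOpen H) φ) :
    ∃ (Q : MvPolynomial (Fin m) k) (n : ℕ),
      ∀ z ∈ principalOpen H, eval z H ^ n * φ z = eval z Q := by
  have hH : H ∈ (denominatorIdeal H φ).radical := by
    rw [← vanishingIdeal_zeroLocus_eq_radical (K := k)]
    exact fun z hz => eval_eq_zero_of_mem_zeroLocus_denominatorIdeal hφ hz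
  obtain ⟨n, Q, hQ⟩ := hH
  exact ⟨Q, n, fun z hz => by rw [← hQ z hz, map_pow]⟩

/-- The closed subset `H(z) w = 1` of affine space, with coordinates `(z, w)`. -/
def rabinowitschSet (H : MvPolynomial (Fin m) k) : Set (Fin (m + 1) → k) :=
  {z | eval (Fin.init z : Fin m → k) H * z (Fin.last m) = 1}

lemma isClosed_rabinowitschSet (H : MvPolynomial (Fin m) k) :
    IsClosed[(affineSpace k (m + 1)).top] (rabinowitschSet H) := by
  rw [← @isOpen_compl_iff _ _ (affineSpace k (m + 1)).top]
  convert Basics.isOpen_of_mem (𝒳 := affineSpace k (m + 1))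
    ⟨0, rename Fin.castSucc H * X (Fin.last m) - 1, rfl⟩ using 1
  ext z
  simp only [rabinowitschSet, Set.mem_compl_iff, Set.mem_ofPred_eq, map_sub, map_mul, eval_rename,
    eval_X, map_one, ne_eq, sub_eq_zero]
  rfl

variable {X : Type*} {𝒳 : Basics k X} [𝒳.IsFractional] {S : Set X}

lemma isAffine_of_areIsomorphic_principalOpen {H : MvPolynomial (Fin m) k}
    (h : AreIsomorphic 𝒳 (affineSpace k m) S (principalOpen H)) : 𝒳.IsAffine S := by
  obtain ⟨u, v, hu, hv, hvu, huv⟩ := h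
  have hinit : IsMorphism (affineSpace k (m + 1)) (affineSpace k m) (fun z => Fin.init z)
      (rabinowitschSet H) (principalOpen H) :=
    isMorphism_affineSpace (fun z hz => left_ne_zero_of_mul (hz ▸ one_ne_zero))
      fun i => Basics.regularOn_coord _ i.castSucc
  refine ⟨m + 1, rabinowitschSet H, isClosed_rabinowitschSet H,
    fun x => Fin.snoc (u x) (eval (u x) H)⁻¹, v ∘ fun z => Fin.init z,
    isMorphism_affineSpace (fun x hx => ?_) fun i => ?_, hv.comp hinit, fun x hx => ?_,
    fun z hz => ?_⟩
  · simpa [rabinowitschSet] using mul_inv_cancel₀ (hu.1 hx)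
  · induction i using Fin.lastCases with
    | last => simpa using (Basics.RegularOn.eval hu.regularOn_coord H).inv hu.1
    | cast i => simpa using hu.regularOn_coord i
  · simpa using hvu x hx
  · have hlast : (eval (Fin.init z : Fin m → k) H)⁻¹ = z (Fin.last m) :=
      inv_eq_of_mul_eq_one_right hz
    simp only [Function.comp_apply]
    rw [huv _ (hinit.1 hz), hlast, Fin.snoc_init_self]

end PrincipalOpen

/-! ### The projective plane and its square -/

section Plane

variable {k : Type*} [Field k]

instance : (plane k).IsFractional :=
  inferInstanceAs (gradedBasics (1 : Fin 3 → ℕ) (Projectivization.rep (K := k))).IsFractional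

instance : (planeSq k).IsFractional :=
  inferInstanceAs (gradedBasics biweight
    fun R : P2 k × P2 k => Sum.elim R.1.rep R.2.rep).IsFractional

lemma eval_smul_of_isHomogeneous {σ : Type*} {A : MvPolynomial σ k} {e : ℕ}
    (hA : A.IsHomogeneous e) (c : k) (v : σ → k) : eval (c • v) A = c ^ e * eval v A := by
  simpa [Pi.smul_def] using eval_mul_of_isWeightedHomogeneous hA (powersHom k c) v

lemma isWeightedHomogeneous_rename {σ τ M N : Type*} [AddCommMonoid M] [AddCommMonoid N]
    {w : σ → M} {w' : τ → N} (f : σ → τ) (g : M →+ N) (hg : ∀ i, w' (f i) = g (w i))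
    {A : MvPolynomial σ k} {e : M} (hA : A.IsWeightedHomogeneous w e) :
    (rename f A).IsWeightedHomogeneous w' (g e) := by
  have hw (m : σ →₀ ℕ) : Finsupp.weight w' (m.mapDomain f) = g (Finsupp.weight w m) := by
    induction m using Finsupp.induction_linear with
    | zero => simp
    | add a b ha hb => rw [Finsupp.mapDomain_add, map_add, map_add, map_add, ha, hb]
    | single i j => simp [Finsupp.weight_apply, hg]
  induction hA using IsWeightedHomogeneous.induction_on with
  | zero => simpa using isWeightedHomogeneous_zero k w' (g e)
  | add p q _ _ hp hq => simpa using hp.add hq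
  | monomial m r hr =>
    rw [rename_monomial]
    exact isWeightedHomogeneous_monomial _ _ _ (by rw [hw, hr])

lemma isMorphism_fst {S : Set (P2 k × P2 k)} {T : Set (P2 k)} (h : Set.MapsTo Prod.fst S T) :
    IsMorphism (planeSq k) (plane k) Prod.fst S T := by
  refine isMorphism_of_forall_comp_mem h ?_
  rintro _ _ ⟨e, A, B, hA, hB, rfl, rfl⟩
  have hinl {Q : MvPolynomial (Fin 3) k} (hQ : Q.IsHomogeneous e) :=
    isWeightedHomogeneous_rename (w' := biweight) Sum.inl (AddMonoidHom.inl ℕ ℕ) (fun _ => rfl) hQ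
  exact ⟨_, _, _, hinl hA, hinl hB, by simp [eval_rename, Function.comp_def]⟩

lemma isMorphism_snd {S : Set (P2 k × P2 k)} {T : Set (P2 k)} (h : Set.MapsTo Prod.snd S T) :
    IsMorphism (planeSq k) (plane k) Prod.snd S T := by
  refine isMorphism_of_forall_comp_mem h ?_
  rintro _ _ ⟨e, A, B, hA, hB, rfl, rfl⟩
  have hinr {Q : MvPolynomial (Fin 3) k} (hQ : Q.IsHomogeneous e) :=
    isWeightedHomogeneous_rename (w' := biweight) Sum.inr (AddMonoidHom.inr ℕ ℕ) (fun _ => rfl) hQ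
  exact ⟨_, _, _, hinr hA, hinr hB, by simp [eval_rename, Function.comp_def]⟩

lemma regularOn_eval_div_eval {e : ℕ} {A B : MvPolynomial (Fin 3) k} (hA : A.IsHomogeneous e)
    (hB : B.IsHomogeneous e) {T : Set (P2 k)} (hT : ∀ P ∈ T, eval P.rep B ≠ 0) :
    (plane k).RegularOn T fun P => eval P.rep A / eval P.rep B := fun P hP =>
  ⟨_, _, ⟨e, A, B, hA, hB, rfl⟩, hT P hP, fun _ _ => rfl⟩

lemma dense_of_forall_exists_eval_ne_zero {S : Set (P2 k)}
    (h : ∀ (e : ℕ) (B : MvPolynomial (Fin 3) k), B.IsHomogeneous e → B ≠ 0 →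
      ∃ P ∈ S, eval P.rep B ≠ 0) : @Dense _ (plane k).top S := by
  let _ := (plane k).top
  rw [dense_iff_inter_open]
  rintro O hO ⟨P, hP⟩
  obtain ⟨_, _, ⟨e, A, B, -, hB, rfl, rfl⟩, hPB, hBO⟩ :=
    Basics.exists_mem_subset_of_isOpen hO hP
  obtain ⟨Q, hQ, hQB⟩ := h e B hB (by rintro rfl; simp at hPB)
  exact ⟨Q, hBO hQB, hQ⟩

/-- The point `(a : b : 1)` of the plane. -/
def chart (z : Fin 2 → k) : P2 k :=
  Projectivization.mk k ![z 0, z 1, 1] fun h => one_ne_zero (congrFun h 2)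

/-- The affine coordinates `(x / z, y / z)` of the point `F(P)`, where `F = (x : y : z)`. They are
only meaningful where `z` does not vanish. -/
def imageCoords (F : Triple k) (P : P2 k) : Fin 2 → k :=
  ![eval P.rep (F 0) / eval P.rep (F 2), eval P.rep (F 1) / eval P.rep (F 2)]

/-- The affine coordinates of a point of the plane, a left inverse of `chart`. -/
abbrev coords (P : P2 k) : Fin 2 → k := imageCoords X P

lemma mk_rep_eq_smul {v : Fin 3 → k} (hv : v ≠ 0) :
    ∃ c : k, c ≠ 0 ∧ (Projectivization.mk k v hv).rep = c • v := by
  obtain ⟨a, ha⟩ := Projectivization.exists_smul_eq_mk_rep k v hv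
  exact ⟨a, a.ne_zero, ha.symm⟩

lemma chart_rep (z : Fin 2 → k) : ∃ c : k, c ≠ 0 ∧ (chart z).rep = c • ![z 0, z 1, 1] :=
  mk_rep_eq_smul _

lemma chart_rep_two_ne_zero (z : Fin 2 → k) : (chart z).rep 2 ≠ 0 := by
  obtain ⟨c, hc, h⟩ := chart_rep z
  simpa [h] using hc

lemma coords_mk {v : Fin 3 → k} (hv : v ≠ 0) :
    coords (Projectivization.mk k v hv) = ![v 0 / v 2, v 1 / v 2] := by
  obtain ⟨c, hc, h⟩ := mk_rep_eq_smul hv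
  simp [coords, imageCoords, h, mul_div_mul_left _ _ hc]

lemma coords_chart (z : Fin 2 → k) : coords (chart z) = z := by
  rw [chart, coords_mk]
  funext i
  fin_cases i <;> simp

lemma chart_coords {P : P2 k} (hP : P.rep 2 ≠ 0) : chart (coords P) = P := by
  conv_rhs => rw [← P.mk_rep]
  rw [chart, Projectivization.mk_eq_mk_iff']
  refine ⟨(P.rep 2)⁻¹, funext fun i => ?_⟩
  fin_cases i <;> simp [coords, imageCoords, hP, div_eq_inv_mul]

lemma imageCoords_chart {F : Triple k} {e : ℕ} (hF : ∀ i, (F i).IsHomogeneous e) (z : Fin 2 → k) :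
    imageCoords F (chart z) = ![eval ![z 0, z 1, 1] (F 0) / eval ![z 0, z 1, 1] (F 2),
      eval ![z 0, z 1, 1] (F 1) / eval ![z 0, z 1, 1] (F 2)] := by
  obtain ⟨c, hc, h⟩ := chart_rep z
  simp only [imageCoords, h, eval_smul_of_isHomogeneous (hF _),
    mul_div_mul_left _ _ (pow_ne_zero _ hc)]

lemma regularOn_imageCoords {F : Triple k} {e : ℕ} (hF : ∀ i, (F i).IsHomogeneous e)
    {T : Set (P2 k)} (hT : ∀ P ∈ T, eval P.rep (F 2) ≠ 0) (i : Fin 2) :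
    (plane k).RegularOn T fun P => imageCoords F P i := by
  fin_cases i
  · exact regularOn_eval_div_eval (hF 0) (hF 2) hT
  · exact regularOn_eval_div_eval (hF 1) (hF 2) hT

lemma regularOn_coords {T : Set (P2 k)} (hT : ∀ P ∈ T, P.rep 2 ≠ 0) (i : Fin 2) :
    (plane k).RegularOn T fun P => coords P i :=
  regularOn_imageCoords (isHomogeneous_X k) (by simpa using hT) i

section IntoPlane

variable {Y : Type*} {𝒴 : Basics k Y} [𝒴.IsFractional] {S : Set Y}

lemma regularOn_vec {t : Y → Fin 2 → k} (ht : ∀ i, 𝒴.RegularOn S fun y => t y i) (i : Fin 3) :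
    𝒴.RegularOn S fun y => (![t y 0, t y 1, 1] : Fin 3 → k) i := by
  fin_cases i
  · exact ht 0
  · exact ht 1
  · exact (𝒴.regularAlgebra S).one_mem

lemma isMorphism_chart {t : Y → Fin 2 → k} (ht : ∀ i, 𝒴.RegularOn S fun y => t y i)
    {T : Set (P2 k)} (hu : Set.MapsTo (fun y => chart (t y)) S T) :
    IsMorphism 𝒴 (plane k) (fun y => chart (t y)) S T := by
  refine isMorphism_gradedBasics hu (regularOn_vec ht) fun y _ => ?_
  obtain ⟨c, hc, h⟩ := chart_rep (t y)
  exact ⟨powersHom k c, fun m => pow_ne_zero _ hc, fun i => by simp [h]⟩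

lemma isMorphism_chart_prod {s t : Y → Fin 2 → k} (hs : ∀ i, 𝒴.RegularOn S fun y => s y i)
    (ht : ∀ i, 𝒴.RegularOn S fun y => t y i) {T : Set (P2 k × P2 k)}
    (hu : Set.MapsTo (fun y => (chart (s y), chart (t y))) S T) :
    IsMorphism 𝒴 (planeSq k) (fun y => (chart (s y), chart (t y))) S T := by
  refine isMorphism_gradedBasics (w := biweight)
    (t := fun y => Sum.elim ![s y 0, s y 1, 1] ![t y 0, t y 1, 1]) hu ?_ fun y _ => ?_
  · rintro (i | i)
    · exact regularOn_vec hs i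
    · exact regularOn_vec ht i
  · obtain ⟨c, hc, h⟩ := chart_rep (s y)
    obtain ⟨c', hc', h'⟩ := chart_rep (t y)
    refine ⟨(powersHom k c).comp (AddMonoidHom.toMultiplicative (.fst ℕ ℕ)) *
      (powersHom k c').comp (AddMonoidHom.toMultiplicative (.snd ℕ ℕ)),
      fun m => mul_ne_zero (pow_ne_zero _ hc) (pow_ne_zero _ hc'), ?_⟩
    rintro (i | i) <;>
      simp only [h, h', biweight, Sum.elim_inl, Sum.elim_inr, Pi.smul_apply, smul_eq_mul] <;> simp

end IntoPlane

lemma isOpen_rep_two_ne_zero_inter (H : MvPolynomial (Fin 2) k) :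
    IsOpen[(plane k).top] {P : P2 k | P.rep 2 ≠ 0 ∧ eval (coords P) H ≠ 0} := by
  have hfin : IsOpen[(plane k).top] {P : P2 k | P.rep 2 ≠ 0} := Basics.isOpen_of_mem
    ⟨1, 0, X 2, isHomogeneous_zero _ _ _, isHomogeneous_X _ _, by simp; rfl⟩
  obtain ⟨O, hO, he⟩ := (Basics.RegularOn.eval (regularOn_coords (k := k)
    (T := {P | P.rep 2 ≠ 0}) fun _ h => h) H).openIn_ne_zero
  have := @IsOpen.inter _ (plane k).top _ _ hfin hO
  rwa [← he] at this

lemma areIsomorphic_coords (H : MvPolynomial (Fin 2) k) :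
    AreIsomorphic (plane k) (affineSpace k 2) {P | P.rep 2 ≠ 0 ∧ eval (coords P) H ≠ 0}
      (principalOpen H) :=
  ⟨coords, chart, isMorphism_affineSpace (fun _ hP => hP.2) (regularOn_coords fun _ hP => hP.1),
    isMorphism_chart (Basics.regularOn_coord _) fun z hz => ⟨chart_rep_two_ne_zero z, by
      rwa [coords_chart]⟩,
    fun _ hP => chart_coords hP.1, fun z _ => coords_chart z⟩

end Plane

section Sends

variable {k : Type*} [Field k] {F : Triple k} {e : ℕ} {P Q : P2 k}

lemma sends_iff (hF : Represents F F e) (h0 : F 0 ≠ 0) (h01 : IsRelPrime (F 0) (F 1)) :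
    Sends F P Q ↔
      ∃ h : (fun i => eval P.rep (F i)) ≠ 0, Q = Projectivization.mk k _ h := by
  refine ⟨fun ⟨e', G, hG, h, hQ⟩ => ?_, fun h => ⟨e, F, hF, h⟩⟩
  obtain ⟨q, hq⟩ := hG.exists_eq_mul h0 h01
  have hGF : (fun i => eval P.rep (G i)) = eval P.rep q • fun i => eval P.rep (F i) :=
    funext fun i => by simp [hq i]
  have hF0 : (fun i => eval P.rep (F i)) ≠ 0 := fun h0 => h (by rw [hGF, h0, smul_zero])
  refine ⟨hF0, hQ.trans ?_⟩
  rw [Projectivization.mk_eq_mk_iff']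
  exact ⟨eval P.rep q, hGF.symm⟩

lemma sends_mk (hF : Represents F F e) {v : Fin 3 → k} (hv : v ≠ 0)
    (h : (fun i => eval v (F i)) ≠ 0) :
    Sends F (Projectivization.mk k v hv) (Projectivization.mk k _ h) := by
  obtain ⟨c, hc, hrep⟩ := mk_rep_eq_smul hv
  have he : (fun i => eval (Projectivization.mk k v hv).rep (F i)) =
      c ^ e • fun i => eval v (F i) :=
    funext fun i => by rw [hrep, eval_smul_of_isHomogeneous (hF.2.1 i)]; rfl
  refine ⟨e, F, hF, he ▸ smul_ne_zero (pow_ne_zero _ hc) h, ?_⟩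
  rw [Projectivization.mk_eq_mk_iff']
  exact ⟨(c ^ e)⁻¹, by rw [he, inv_smul_smul₀ (pow_ne_zero _ hc)]⟩

lemma sends_chart_imageCoords (hF : Represents F F e) (h2 : eval P.rep (F 2) ≠ 0) :
    Sends F P (chart (imageCoords F P)) := by
  refine ⟨e, F, hF, fun h => h2 (congrFun h 2), ?_⟩
  rw [chart, Projectivization.mk_eq_mk_iff']
  refine ⟨(eval P.rep (F 2))⁻¹, funext fun i => ?_⟩
  fin_cases i <;> simp [imageCoords, div_eq_inv_mul, h2]

lemma isDominant_of_bind₁_injective [Infinite k] (hF : Represents F F e)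
    (h : Function.Injective (bind₁ F)) : IsDominant F := by
  refine dense_of_forall_exists_eval_ne_zero fun e' B hB hB0 => ?_
  have hF0 : F 0 ≠ 0 := by
    simpa using h.ne (X_ne_zero 0 : (X 0 : MvPolynomial (Fin 3) k) ≠ 0)
  have hBF : bind₁ F B ≠ 0 := by simpa using h.ne hB0
  obtain ⟨v, hv⟩ : ∃ v, eval v (X 0 * F 0 * bind₁ F B) ≠ 0 := by
    by_contra! hcon
    exact mul_ne_zero (mul_ne_zero (X_ne_zero 0) hF0) hBF
      (MvPolynomial.funext fun w => by simpa using hcon w)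
  simp only [map_mul, eval_X, eval_bind₁, mul_ne_zero_iff] at hv
  obtain ⟨⟨hv0, hFv⟩, hBv⟩ := hv
  have himage : (fun i => eval v (F i)) ≠ 0 := fun h => hFv (congrFun h 0)
  refine ⟨_, ⟨_, sends_mk hF (fun h => hv0 (congrFun h 0)) himage⟩, ?_⟩
  obtain ⟨a, ha, hrep⟩ := mk_rep_eq_smul himage
  rw [hrep, eval_smul_of_isHomogeneous hB]
  exact mul_ne_zero (pow_ne_zero _ ha) hBv

lemma isCohHyperbolic_one_of_lt {δ₁ δ₂ : ℝ} (hF : IsDominant F) (h₁ : HasDynDegree F 1 δ₁)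
    (h₂ : HasDynDegree F 2 δ₂) (h : δ₂ < δ₁) : IsCohHyperbolic F 1 := by
  refine ⟨hF, fun i => if i = 1 then δ₁ else δ₂, ?_, fun j => ?_⟩
  · simp [show Finset.Icc 1 2 = {1, 2} from rfl, h₁, h₂]
  · simp only [show Finset.Icc 1 2 = {1, 2} from rfl, Finset.mem_insert, Finset.mem_singleton,
      forall_eq_or_imp, forall_eq]
    constructor
    · rintro ⟨rfl | rfl, h1, -⟩
      · rfl
      · exact absurd (by simpa using h1) h.not_ge
    · rintro rfl
      simpa using h.le

variable {m : ℕ} {c : k}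

lemma isCohHyperbolic_recurrenceMap [IsAlgClosed k] [NeZero (2 : k)] (hc : c ≠ 0) :
    IsCohHyperbolic (recurrenceMap m c) 1 :=
  have := IsAlgClosed.instInfinite (K := k)
  isCohHyperbolic_one_of_lt
    (isDominant_of_bind₁_injective represents_recurrenceMap bind₁_recurrenceMap_injective)
    (hasDynDegree_recurrenceMap_one hc) hasDynDegree_recurrenceMap_two
    (by push_cast; linarith [(Nat.cast_nonneg m : (0 : ℝ) ≤ m)])

end Sends

/-! ### Finite morphisms -/

section Finite

variable {k X Y : Type*} [Field k] {𝒳 : Basics k X} {𝒴 : Basics k Y} [𝒳.IsFractional]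
  [𝒴.IsFractional] {g : X → Y} {S : Set X} {T : Set Y}

variable (𝒴 g S T) in
/-- The algebra of the functions on `S` that are pullbacks along `g` of regular functions on `T`.
For `g = id` and `S = T` these are the restrictions to `S` of regular functions on `S`. -/
def pullbackAlgebra : Subalgebra k (S → k) :=
  (𝒴.regularAlgebra T).map (AlgHom.pi fun s : S => Pi.evalAlgHom k (fun _ => k) (g s))

lemma mem_pullbackAlgebra {f : S → k} :
    f ∈ pullbackAlgebra 𝒴 g S T ↔ ∃ a, 𝒴.RegularOn T a ∧ (fun s : S => a (g s)) = f :=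
  Iff.rfl

lemma IsMorphism.pullbackAlgebra_le (hg : IsMorphism 𝒳 𝒴 g S T) :
    pullbackAlgebra 𝒴 g S T ≤ pullbackAlgebra 𝒳 id S S := by
  rintro _ ⟨a, ha, rfl⟩
  exact ⟨a ∘ g, hg.comp_regularOn ha, rfl⟩

lemma isFiniteMorphism_of_adjoin_eq (hg : IsMorphism 𝒳 𝒴 g S T) (hS : 𝒳.IsAffine S)
    (hT : 𝒴.IsAffine T) {s : Set (S → k)} (hs : s.Finite)
    (hadj : Algebra.adjoin k s = pullbackAlgebra 𝒳 id S S)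
    (hintegral : ∀ f ∈ s, IsIntegral (pullbackAlgebra 𝒴 g S T) f) : IsFiniteMorphism 𝒳 𝒴 g S T := by
  refine ⟨hg, fun Q hQ => ⟨T, hQ, ⟨Set.univ, @isOpen_univ _ 𝒴.top, (Set.inter_univ T).symm⟩, hT,
    ?_⟩⟩
  rw [show S ∩ g ⁻¹' T = S from Set.inter_eq_left.mpr hg.1]
  have hspan : (Algebra.adjoin (pullbackAlgebra 𝒴 g S T) s).restrictScalars k =
      pullbackAlgebra 𝒳 id S S := by
    rw [Algebra.restrictScalars_adjoin, ← hadj, Algebra.adjoin_union, Algebra.adjoin_eq,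
      sup_eq_right, hadj]
    exact hg.pullbackAlgebra_le
  obtain ⟨r, b, hb⟩ := Submodule.fg_iff_exists_fin_generating_family.mp
    (fg_adjoin_of_finite hs hintegral)
  have hmem (f : S → k) : f ∈ Submodule.span (pullbackAlgebra 𝒴 g S T) (Set.range b) ↔
      ∃ φ, 𝒳.RegularOn S φ ∧ (fun s : S => φ s) = f := by
    rw [hb, Subalgebra.mem_toSubmodule, ← Subalgebra.mem_restrictScalars k, hspan,
      mem_pullbackAlgebra]
    rfl
  choose b' hb' hbb' using fun i => (hmem (b i)).mp (Submodule.subset_span ⟨i, rfl⟩)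
  refine ⟨hS, r, b', hb', fun φ hφ => ?_⟩
  obtain ⟨c, hc⟩ := (Submodule.mem_span_range_iff_exists_fun _).mp ((hmem _).mpr ⟨φ, hφ, rfl⟩)
  choose a ha hac using fun i => mem_pullbackAlgebra.mp (c i).2
  refine ⟨a, ha, fun x hx => (congrFun hc ⟨x, hx⟩).symm.trans ?_⟩
  rw [Finset.sum_apply]
  exact Finset.sum_congr rfl fun i _ =>
    congrArg₂ (· * ·) (congrFun (hac i) ⟨x, hx⟩).symm (congrFun (hbb' i) ⟨x, hx⟩).symm

variable {m : ℕ} {H : MvPolynomial (Fin m) k} {u : X → Fin m → k} {v : (Fin m → k) → X}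

lemma adjoin_coord_union_inv_eq [IsAlgClosed k]
    (hu : IsMorphism 𝒳 (affineSpace k m) u S (principalOpen H))
    (hv : IsMorphism (affineSpace k m) 𝒳 v (principalOpen H) S) (hvu : ∀ x ∈ S, v (u x) = x) :
    Algebra.adjoin k (insert (fun s : S => (eval (u s) H)⁻¹) (Set.range fun i (s : S) => u s i)) =
      pullbackAlgebra 𝒳 id S S := by
  apply le_antisymm
  · refine Algebra.adjoin_le (Set.insert_subset ?_ (Set.range_subset_iff.mpr fun i => ?_))
    · exact ⟨_, (Basics.RegularOn.eval hu.regularOn_coord H).inv hu.1, rfl⟩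
    · exact ⟨_, hu.regularOn_coord i, rfl⟩
  · rintro _ ⟨φ, hφ, rfl⟩
    obtain ⟨Q, n, hQ⟩ := exists_pow_mul_eq_eval (hv.comp_regularOn hφ)
    have hφQ : (fun s : S => φ s) =
        (fun s : S => (eval (u s) H)⁻¹) ^ n * fun s : S => eval (u s) Q := funext fun s => by
      have hs : eval (u s) H ≠ 0 := hu.1 s.2
      rw [Pi.mul_apply, Pi.pow_apply, ← hQ _ hs, Function.comp_apply, hvu s s.2, inv_pow,
        inv_mul_cancel_left₀ (pow_ne_zero n hs)]
    change (fun s : S => φ s) ∈ _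
    rw [hφQ]
    exact mul_mem (pow_mem (Algebra.subset_adjoin (Set.mem_insert _ _)) n)
      (eval_mem_of_forall_mem (fun i => Algebra.subset_adjoin (.inr ⟨i, rfl⟩)) Q)

lemma isFiniteMorphism_of_isIntegral [IsAlgClosed k] (hg : IsMorphism 𝒳 𝒴 g S T)
    (hT : 𝒴.IsAffine T) (hu : IsMorphism 𝒳 (affineSpace k m) u S (principalOpen H))
    (hv : IsMorphism (affineSpace k m) 𝒳 v (principalOpen H) S) (hvu : ∀ x ∈ S, v (u x) = x)
    (huv : ∀ z ∈ principalOpen H, u (v z) = z)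
    (hintegral : ∀ i, IsIntegral (pullbackAlgebra 𝒴 g S T) fun s : S => u s i)
    (hinv : IsIntegral (pullbackAlgebra 𝒴 g S T) fun s : S => (eval (u s) H)⁻¹) :
    IsFiniteMorphism 𝒳 𝒴 g S T :=
  isFiniteMorphism_of_adjoin_eq hg
    (isAffine_of_areIsomorphic_principalOpen ⟨u, v, hu, hv, hvu, huv⟩) hT
    ((Set.finite_range _).insert _) (adjoin_coord_union_inv_eq hu hv hvu)
    (by rintro _ (rfl | ⟨i, rfl⟩); exacts [hinv, hintegral i])

end Finite

/-! ### Backward branches -/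

section Branches

variable {k : Type*} [Field k]

lemma exists_clear_denominator {σ τ : Type*} (A : τ → MvPolynomial σ k) (D : MvPolynomial σ k)
    (H : MvPolynomial τ k) : ∃ (G : MvPolynomial σ k) (M : ℕ), ∀ z, eval z D ≠ 0 →
      eval z G = eval z D ^ M * eval (fun i => eval z (A i) / eval z D) H := by
  induction H using MvPolynomial.induction_on with
  | C a => exact ⟨C a, 0, by simp⟩
  | add H H' h h' =>
    obtain ⟨G, M, hG⟩ := h
    obtain ⟨G', M', hG'⟩ := h'
    refine ⟨D ^ M' * G + D ^ M * G', M + M', fun z hz => ?_⟩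
    simp only [map_add, map_mul, map_pow, hG z hz, hG' z hz]
    ring
  | mul_X H i h =>
    obtain ⟨G, M, hG⟩ := h
    refine ⟨G * A i, M + 1, fun z hz => ?_⟩
    simp only [map_mul, eval_X, hG z hz]
    field_simp
    ring

lemma exists_even_odd (H : MvPolynomial (Fin 2) k) : ∃ p q : MvPolynomial (Fin 2) k,
    ∀ x t, eval ![x, t] H = eval ![x, t ^ 2] p + t * eval ![x, t ^ 2] q := by
  induction H using MvPolynomial.induction_on with
  | C a => exact ⟨C a, 0, by simp⟩
  | add H H' h h' =>
    obtain ⟨p, q, hpq⟩ := h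
    obtain ⟨p', q', hpq'⟩ := h'
    refine ⟨p + p', q + q', fun x t => ?_⟩
    simp only [map_add, hpq, hpq']
    ring
  | mul_X H i h =>
    obtain ⟨p, q, hpq⟩ := h
    fin_cases i
    · refine ⟨p * X 0, q * X 0, fun x t => ?_⟩
      simp only [Fin.zero_eta, map_mul, eval_X, Matrix.cons_val_zero, hpq]
      ring
    · refine ⟨q * X 1, p, fun x t => ?_⟩
      simp only [Fin.mk_one, map_mul, eval_X, Matrix.cons_val_one, Matrix.cons_val_fin_one, hpq]
      ring

/-- The point `z` of the affine plane is mapped to `w` by `recurrenceMap m c`, in the form without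
denominators. -/
def IsPreimage (m : ℕ) (c : k) (w z : Fin 2 → k) : Prop :=
  z 0 = w 1 ∧ (w 0 + c) * z 1 ^ 2 = w 1 ^ (m + 3)

variable (m : ℕ) (c : k)

-- The two preimages of `w` are exchanged by the sign of the second coordinate, so the product of
-- the values of `H` at them is a polynomial in `w₁` and `z₁² = w₁ᵐ⁺³ / (w₀ + c)`.
lemma exists_branchNorm (H : MvPolynomial (Fin 2) k) :
    ∃ (G : MvPolynomial (Fin 2) k) (M : ℕ), ∀ w z, w 0 + c ≠ 0 → IsPreimage m c w z →
      eval w G = (w 0 + c) ^ M * (eval z H * eval ![z 0, -z 1] H) := by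
  obtain ⟨p, q, hpq⟩ := exists_even_odd H
  obtain ⟨G, M, hG⟩ := exists_clear_denominator (σ := Fin 2)
    ![X 1 * (X 0 + C c), X 1 ^ (m + 3)] (X 0 + C c) (p ^ 2 - X 1 * q ^ 2)
  refine ⟨G, M, fun w z hw ⟨h0, h1⟩ => ?_⟩
  have hz : (fun i => eval w ((![X 1 * (X 0 + C c), X 1 ^ (m + 3)] :
      Fin 2 → MvPolynomial (Fin 2) k) i) / eval w (X 0 + C c)) = ![z 0, z 1 ^ 2] := by
    funext i
    fin_cases i
    · simp [h0, hw]
    · simp [← h1, hw]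
  have hz' : z = ![z 0, z 1] := (FinVec.etaExpand_eq z).symm
  rw [hG w (by simpa using hw), hz]
  conv_rhs => rw [hz']
  simp only [Matrix.cons_val_zero, Matrix.cons_val_one, Matrix.cons_val_fin_one, hpq, map_add,
    map_sub, map_mul, map_pow, eval_X, eval_C, neg_sq]
  ring

/-- Up to a power of `w₀ + c`, the value of this polynomial at `w` is the product of the values
of `H` at the two preimages of `w`. -/
def branchNorm (H : MvPolynomial (Fin 2) k) : MvPolynomial (Fin 2) k :=
  (exists_branchNorm m c H).choose

/-- The polynomial that vanishes at the points with a backward branch of length at most `n` that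
reaches the line `w₁ = 0` or the line `w₀ = -c`. -/
def branchPoly : ℕ → MvPolynomial (Fin 2) k
  | 0 => X 1 * (X 0 + C c)
  | n + 1 => X 1 * (X 0 + C c) * branchNorm m c (branchPoly n)

variable {m c} {n : ℕ} {w z : Fin 2 → k}

lemma exists_eval_branchNorm_eq (H : MvPolynomial (Fin 2) k) :
    ∃ M, ∀ w z, w 0 + c ≠ 0 → IsPreimage m c w z →
      eval w (branchNorm m c H) = (w 0 + c) ^ M * (eval z H * eval ![z 0, -z 1] H) :=
  (exists_branchNorm m c H).choose_spec

lemma exists_branchPoly_eq_mul (n : ℕ) : ∃ G, branchPoly m c n = X 1 * (X 0 + C c) * G := by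
  cases n with
  | zero => exact ⟨1, (mul_one _).symm⟩
  | succ n => exact ⟨_, rfl⟩

lemma ne_zero_of_eval_branchPoly_ne_zero (h : eval w (branchPoly m c n) ≠ 0) :
    w 1 ≠ 0 ∧ w 0 + c ≠ 0 := by
  obtain ⟨G, hG⟩ := exists_branchPoly_eq_mul (m := m) (c := c) n
  simp only [hG, map_mul, map_add, eval_X, eval_C, mul_ne_zero_iff] at h
  exact h.1

lemma IsPreimage.eval_branchPoly_ne_zero (hz : IsPreimage m c w z)
    (h : eval w (branchPoly m c (n + 1)) ≠ 0) : eval z (branchPoly m c n) ≠ 0 := by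
  obtain ⟨M, hM⟩ := exists_eval_branchNorm_eq (m := m) (c := c) (branchPoly m c n)
  simp only [branchPoly, map_mul, hM w z (ne_zero_of_eval_branchPoly_ne_zero h).2 hz,
    mul_ne_zero_iff] at h
  exact h.2.2.1

lemma eval_branchPoly_succ_ne_zero [IsAlgClosed k] (h1 : w 1 ≠ 0) (h0 : w 0 + c ≠ 0)
    (h : ∀ z, IsPreimage m c w z → eval z (branchPoly m c n) ≠ 0) :
    eval w (branchPoly m c (n + 1)) ≠ 0 := by
  obtain ⟨t, ht⟩ := IsAlgClosed.exists_pow_nat_eq (w 1 ^ (m + 3) / (w 0 + c)) two_pos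
  have hw : IsPreimage m c w ![w 1, t] := ⟨rfl, by simp [ht, mul_div_cancel₀ _ h0]⟩
  have hw' : IsPreimage m c w ![w 1, -t] := ⟨rfl, by simp [ht, mul_div_cancel₀ _ h0]⟩
  obtain ⟨M, hM⟩ := exists_eval_branchNorm_eq (m := m) (c := c) (branchPoly m c n)
  rw [branchPoly, map_mul, hM w _ h0 hw]
  simpa using ⟨⟨h1, h0⟩, fun h => (h0 h).elim, h _ hw, h _ hw'⟩

end Branches

section Integrality

variable {k Y : Type*} [Field k] {m n : ℕ} {c : k} {B : Subalgebra k (Y → k)}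

lemma IsPreimage.mem_of_mem (hB : ∀ f, f ^ 2 ∈ B → f ∈ B) {w z : Y → Fin 2 → k}
    (hwz : ∀ y, IsPreimage m c (w y) (z y))
    (hne : ∀ y, eval (w y) (branchPoly m c (n + 1)) ≠ 0) (hw : ∀ i, (fun y => w y i) ∈ B)
    (hinv : (fun y => (eval (w y) (branchPoly m c (n + 1)))⁻¹) ∈ B) (i : Fin 2) :
    (fun y => z y i) ∈ B := by
  have h0 (y : Y) : z y 0 = w y 1 := (hwz y).1
  fin_cases i
  · simpa only [Fin.zero_eta, h0] using hw 1
  · refine hB _ ?_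
    have he : (fun y => z y 1) ^ 2 = (fun y => eval (w y)
        (X 1 ^ (m + 3) * (X 1 * branchNorm m c (branchPoly m c n)))) *
          fun y => (eval (w y) (branchPoly m c (n + 1)))⁻¹ := by
      funext y
      have hy := hne y
      simp only [branchPoly, map_mul, map_add, eval_X, eval_C, mul_ne_zero_iff] at hy
      obtain ⟨⟨h1, hc⟩, hN⟩ := hy
      simp only [Pi.pow_apply, Pi.mul_apply, branchPoly, map_mul, map_add, map_pow, eval_X, eval_C,
        ← (hwz y).2]
      field_simp
    exact he ▸ B.mul_mem (eval_mem_of_forall_mem hw _) hinv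

lemma IsPreimage.inv_eval_branchPoly_mem {w z : Y → Fin 2 → k}
    (hwz : ∀ y, IsPreimage m c (w y) (z y))
    (hne : ∀ y, eval (w y) (branchPoly m c (n + 1)) ≠ 0) (hw : ∀ i, (fun y => w y i) ∈ B)
    (hz : ∀ i, (fun y => z y i) ∈ B)
    (hinv : (fun y => (eval (w y) (branchPoly m c (n + 1)))⁻¹) ∈ B) :
    (fun y => (eval (z y) (branchPoly m c n))⁻¹) ∈ B := by
  obtain ⟨M, hM⟩ := exists_eval_branchNorm_eq (m := m) (c := c) (branchPoly m c n)
  have hconj (i : Fin 2) : (fun y => (![z y 0, -z y 1] : Fin 2 → k) i) ∈ B := by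
    fin_cases i
    · exact hz 0
    · exact B.neg_mem (hz 1)
  have he : (fun y => (eval (z y) (branchPoly m c n))⁻¹) =
      (fun y => eval (w y) (X 1 * (X 0 + C c) ^ (M + 1))) *
        (fun y => eval ![z y 0, -z y 1] (branchPoly m c n)) *
          fun y => (eval (w y) (branchPoly m c (n + 1)))⁻¹ := by
    funext y
    have hy := hne y
    have hc := (ne_zero_of_eval_branchPoly_ne_zero hy).2
    simp only [branchPoly, map_mul, map_add, eval_X, eval_C, hM _ _ hc (hwz y),
      mul_ne_zero_iff] at hy
    obtain ⟨⟨h1, -⟩, -, hz, hz'⟩ := hy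
    simp only [Pi.mul_apply, branchPoly, map_mul, map_add, map_pow, eval_X, eval_C,
      hM _ _ hc (hwz y)]
    field_simp
    ring
  exact he ▸ B.mul_mem (B.mul_mem (eval_mem_of_forall_mem hw _)
    (eval_mem_of_forall_mem hconj _)) hinv

end Integrality

section OrbitCoords

variable {k : Type*} [Field k] {m n i : ℕ} {c : k} {P : P2 k}

variable (m c) in
/-- The affine coordinates of the `n`-th image of `P`. -/
abbrev orbitCoords (n : ℕ) (P : P2 k) : Fin 2 → k := imageCoords (iter (recurrenceMap m c) n) P

lemma eval_iter_succ_two_ne_zero {v : Fin 3 → k} :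
    eval v (iter (recurrenceMap m c) (n + 1) 2) ≠ 0 ↔
      eval v (iter (recurrenceMap m c) n 1) ≠ 0 ∧ eval v (iter (recurrenceMap m c) n 2) ≠ 0 := by
  simp [iter_recurrenceMap_succ]

lemma eval_iter_two_ne_zero_of_le {v : Fin 3 → k} (hi : i ≤ n)
    (h : eval v (iter (recurrenceMap m c) n 2) ≠ 0) :
    eval v (iter (recurrenceMap m c) i 2) ≠ 0 := by
  induction hi using Nat.decreasingInduction with
  | self => exact h
  | of_succ j _ ih => exact (eval_iter_succ_two_ne_zero.mp ih).2

lemma isPreimage_orbitCoords (h : eval P.rep (iter (recurrenceMap m c) (n + 1) 2) ≠ 0) :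
    IsPreimage m c (orbitCoords m c (n + 1) P) (orbitCoords m c n P) := by
  obtain ⟨h1, h2⟩ := eval_iter_succ_two_ne_zero.mp h
  have h0 : orbitCoords m c n P 0 = orbitCoords m c (n + 1) P 1 := by
    simp only [imageCoords, iter_recurrenceMap_succ, Matrix.cons_val, map_mul, map_pow]
    field_simp
    ring
  refine ⟨h0, ?_⟩
  rw [← h0]
  simp only [imageCoords, iter_recurrenceMap_succ, Matrix.cons_val, map_mul, map_pow, map_sub,
    eval_C, div_pow]
  field_simp
  ring

lemma eval_orbitCoords_branchPoly_ne_zero (hi : i ≤ n)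
    (h : eval P.rep (iter (recurrenceMap m c) n 2) ≠ 0)
    (hP : eval (orbitCoords m c n P) (branchPoly m c n) ≠ 0) :
    eval (orbitCoords m c i P) (branchPoly m c i) ≠ 0 := by
  induction hi using Nat.decreasingInduction with
  | self => exact hP
  | of_succ j hj ih =>
    exact (isPreimage_orbitCoords (eval_iter_two_ne_zero_of_le hj h)).eval_branchPoly_ne_zero ih

variable {Y : Type*} {B : Subalgebra k (Y → k)} {p : Y → P2 k}

lemma orbitCoords_mem (hB : ∀ f, f ^ 2 ∈ B → f ∈ B)
    (h : ∀ y, eval (p y).rep (iter (recurrenceMap m c) n 2) ≠ 0)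
    (hp : ∀ y, eval (orbitCoords m c n (p y)) (branchPoly m c n) ≠ 0)
    (hn : ∀ j, (fun y => orbitCoords m c n (p y) j) ∈ B)
    (hinv : (fun y => (eval (orbitCoords m c n (p y)) (branchPoly m c n))⁻¹) ∈ B) (hi : i ≤ n) :
    (∀ j, (fun y => orbitCoords m c i (p y) j) ∈ B) ∧
      (fun y => (eval (orbitCoords m c i (p y)) (branchPoly m c i))⁻¹) ∈ B := by
  induction hi using Nat.decreasingInduction with
  | self => exact ⟨hn, hinv⟩
  | of_succ j hj ih =>
    have hpre (y : Y) := isPreimage_orbitCoords (eval_iter_two_ne_zero_of_le hj (h y))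
    have hne (y : Y) := eval_orbitCoords_branchPoly_ne_zero hj (h y) (hp y)
    have hmem := IsPreimage.mem_of_mem hB hpre hne ih.1 ih.2
    exact ⟨hmem, IsPreimage.inv_eval_branchPoly_mem hpre hne ih.1 hmem ih.2⟩

end OrbitCoords

/-! ### Finiteness over the locus of nondegenerate backward branches -/

section Closure

variable {k X Y : Type*} [Field k] {𝒳 : Basics k X} [𝒳.IsFractional] {U S : Set X} {x : X}

lemma Basics.RegularOn.eq_zero_of_mem_closure {φ : X → k} (hU : IsOpen[𝒳.top] U)
    (hφ : 𝒳.RegularOn U φ) (hxU : x ∈ U) (hxS : x ∈ @closure _ 𝒳.top S)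
    (h0 : ∀ y ∈ S, y ∈ U → φ y = 0) : φ x = 0 := by
  by_contra hx
  obtain ⟨O, hO, he⟩ := hφ.openIn_ne_zero
  have hUO := @IsOpen.inter _ 𝒳.top _ _ hU hO
  rw [← he] at hUO
  obtain ⟨y, ⟨hyU, hy⟩, hyS⟩ := (@mem_closure_iff _ 𝒳.top _ _).mp hxS _ hUO ⟨hxU, hx⟩
  exact hy (h0 y hyS hyU)

variable {𝒴 : Basics k Y} [𝒴.IsFractional] {g : X → Y} {T : Set Y} {φ : S → k}

lemma exists_monic_equation (hφ : IsIntegral (pullbackAlgebra 𝒴 g S T) φ) :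
    ∃ (N : ℕ) (a : ℕ → Y → k), (∀ j, 𝒴.RegularOn T (a j)) ∧
      ∀ s, φ s ^ N + ∑ j ∈ Finset.range N, a j (g s) * φ s ^ j = 0 := by
  obtain ⟨p, hp, hpφ⟩ := hφ
  choose a ha hap using fun i => mem_pullbackAlgebra.mp (p.coeff i).2
  refine ⟨p.natDegree, a, ha, fun s => ?_⟩
  rw [Polynomial.eval₂_eq_sum_range, Finset.sum_range_succ, hp.coeff_natDegree, map_one,
    one_mul, add_comm] at hpφ
  have hs := congrFun hpφ s
  rw [Pi.add_apply, Finset.sum_apply] at hs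
  exact (congrArg₂ (· + ·) rfl (Finset.sum_congr rfl fun j _ =>
    congrArg (· * φ s ^ j) (congrFun (hap j) s))).trans hs

-- Multiplying a monic equation for `φ` by a power of `β` gives an equation `αᴺ = β * ⋯` with
-- regular coefficients, which extends from `S` to its closure.
lemma eq_zero_of_isIntegral_of_mem_closure (hU : IsOpen[𝒳.top] U) (hg : IsMorphism 𝒳 𝒴 g U T)
    {α β : X → k} (hα : 𝒳.RegularOn U α) (hβ : 𝒳.RegularOn U β)
    (hφ : IsIntegral (pullbackAlgebra 𝒴 g S T) φ) (hαβ : ∀ s : S, α s = φ s * β s) (hxU : x ∈ U)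
    (hxS : x ∈ @closure _ 𝒳.top S) (hβx : β x = 0) : α x = 0 := by
  obtain ⟨N, a, ha, hφ0⟩ := exists_monic_equation hφ
  have hreg : α ^ N + ∑ j ∈ Finset.range N, (a j ∘ g) * (α ^ j * β ^ (N - j)) ∈
      𝒳.regularAlgebra U :=
    add_mem (pow_mem hα N) (sum_mem fun j _ =>
      mul_mem (hg.comp_regularOn (ha j)) (mul_mem (pow_mem hα j) (pow_mem hβ (N - j))))
  have hx := Basics.RegularOn.eq_zero_of_mem_closure hU hreg hxU hxS fun s hs _ => by
    simp only [Pi.add_apply, Finset.sum_apply, Pi.mul_apply, Pi.pow_apply, Function.comp_apply,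
      hαβ ⟨s, hs⟩]
    calc _ = β s ^ N * (φ ⟨s, hs⟩ ^ N + ∑ j ∈ Finset.range N, a j (g s) * φ ⟨s, hs⟩ ^ j) := by
          rw [mul_add, Finset.mul_sum, mul_pow, mul_comm (β s ^ N)]
          congr 1
          refine Finset.sum_congr rfl fun j hj => ?_
          rw [← pow_mul_pow_sub _ (Finset.mem_range.mp hj).le]
          ring
      _ = 0 := by rw [hφ0 ⟨s, hs⟩, mul_zero]
  have hβN : ∀ j ∈ Finset.range N, a j (g x) * (α x ^ j * β x ^ (N - j)) = 0 := fun j hj => by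
    rw [hβx, zero_pow (Nat.sub_ne_zero_of_lt (Finset.mem_range.mp hj)), mul_zero, mul_zero]
  simp only [Pi.add_apply, Finset.sum_apply, Pi.mul_apply, Pi.pow_apply, Function.comp_apply,
    Finset.sum_eq_zero hβN, add_zero] at hx
  exact eq_zero_of_pow_eq_zero hx

end Closure

section PlaneClosure

variable {k : Type*} [Field k]

lemma isOpen_eval_rep_ne_zero {e : ℕ} {B : MvPolynomial (Fin 3) k} (hB : B.IsHomogeneous e) :
    IsOpen[(plane k).top] {P : P2 k | eval P.rep B ≠ 0} :=
  Basics.isOpen_of_mem ⟨e, B, B, hB, hB, rfl⟩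

lemma isOpen_fst_inter_snd {O T : Set (P2 k)} (hO : IsOpen[(plane k).top] O)
    (hT : IsOpen[(plane k).top] T) :
    IsOpen[(planeSq k).top] {R : P2 k × P2 k | R.1 ∈ O ∧ R.2 ∈ T} := by
  obtain ⟨O', hO', he⟩ := (isMorphism_fst (Set.mapsTo_univ _ Set.univ)).openIn_preimage hO
  obtain ⟨T', hT', he'⟩ := (isMorphism_snd (Set.mapsTo_univ _ Set.univ)).openIn_preimage hT
  rw [Set.univ_inter, Set.univ_inter] at he he'
  change IsOpen[(planeSq k).top] (Prod.fst ⁻¹' O ∩ Prod.snd ⁻¹' T)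
  exact he ▸ he' ▸ @IsOpen.inter _ (planeSq k).top _ _ hO' hT'

variable {S : Set (P2 k × P2 k)} {T : Set (P2 k)} {R : P2 k × P2 k}

lemma eval_eq_zero_of_isIntegral_of_mem_closure {e : ℕ} {A B : MvPolynomial (Fin 3) k}
    (hA : A.IsHomogeneous e) (hB : B.IsHomogeneous e) (hB0 : ∀ R ∈ S, eval R.1.rep B ≠ 0)
    (hT : IsOpen[(plane k).top] T)
    (hintegral : IsIntegral (pullbackAlgebra (plane k) Prod.snd S T)
      fun R : S => eval R.1.1.rep A / eval R.1.1.rep B)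
    (hRT : R.2 ∈ T) (hRS : R ∈ @closure _ (planeSq k).top S) (h : eval R.1.rep B = 0) :
    eval R.1.rep A = 0 := by
  obtain ⟨i, hi⟩ := Function.ne_iff.mp R.1.rep_nonzero
  have hXi : (X i ^ e : MvPolynomial (Fin 3) k).IsHomogeneous e := by
    simpa using (isHomogeneous_X k i).pow e
  set U : Set (P2 k × P2 k) := {R | R.1 ∈ {P : P2 k | eval P.rep (X i ^ e) ≠ 0} ∧ R.2 ∈ T}
  have hfst : IsMorphism (planeSq k) (plane k) Prod.fst U {P | eval P.rep (X i ^ e) ≠ 0} :=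
    isMorphism_fst fun _ h => h.1
  have hRi : eval R.1.rep (X i ^ e) ≠ 0 := by simpa using pow_ne_zero e hi
  have key := eq_zero_of_isIntegral_of_mem_closure (x := R)
    (isOpen_fst_inter_snd (isOpen_eval_rep_ne_zero hXi) hT) (isMorphism_snd fun _ h => h.2)
    (hfst.comp_regularOn (regularOn_eval_div_eval hA hXi fun _ h => h))
    (hfst.comp_regularOn (regularOn_eval_div_eval hB hXi fun _ h => h)) hintegral
    (fun s => (div_mul_div_cancel₀ (hB0 s s.2)).symm) ⟨hRi, hRT⟩ hRS
    (by rw [Function.comp_apply, h, zero_div])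
  exact (div_eq_zero_iff.mp key).resolve_right hRi

end PlaneClosure

section BranchGraph

variable {k : Type*} [Field k] {m : ℕ} {c : k} {n i : ℕ} {R : P2 k × P2 k}

variable (m c n) in
/-- The affine points `Q` none of whose backward branches of length at most `n` reaches the lines
`y = 0` and `x = -c z`. -/
def branchSet : Set (P2 k) := {Q | Q.rep 2 ≠ 0 ∧ eval (coords Q) (branchPoly m c n) ≠ 0}

lemma isOpen_branchSet : IsOpen[(plane k).top] (branchSet m c n) :=
  isOpen_rep_two_ne_zero_inter _

lemma isAffine_branchSet : (plane k).IsAffine (branchSet m c n) :=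
  isAffine_of_areIsomorphic_principalOpen (areIsomorphic_coords _)

lemma chart_mem_branchSet {z : Fin 2 → k} :
    chart z ∈ branchSet m c n ↔ eval z (branchPoly m c n) ≠ 0 := by
  simp only [branchSet, Set.mem_ofPred_eq, coords_chart, chart_rep_two_ne_zero, ne_eq,
    not_false_eq_true, true_and]

variable (m c n) in
/-- The part over `branchSet m c n` of the graph of the `n`-th iterate of `recurrenceMap m c`. -/
def branchGraph : Set (P2 k × P2 k) :=
  {R | eval R.1.rep (iter (recurrenceMap m c) n 2) ≠ 0 ∧ R.2 = chart (orbitCoords m c n R.1) ∧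
    R.2 ∈ branchSet m c n}

lemma coords_snd_of_mem_branchGraph (hR : R ∈ branchGraph m c n) :
    coords R.2 = orbitCoords m c n R.1 := by
  rw [hR.2.1, coords_chart]

lemma eval_orbitCoords_ne_zero_of_mem_branchGraph (hR : R ∈ branchGraph m c n) (hi : i ≤ n) :
    eval (orbitCoords m c i R.1) (branchPoly m c i) ≠ 0 :=
  eval_orbitCoords_branchPoly_ne_zero hi hR.1
    (coords_snd_of_mem_branchGraph hR ▸ hR.2.2.2)

lemma sends_iff_mem_branchGraph (hc : c ≠ 0) (hR : R.2 ∈ branchSet m c n) :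
    Sends (iter (recurrenceMap m c) n) R.1 R.2 ↔ R ∈ branchGraph m c n := by
  refine ⟨fun h => ?_, fun h => ?_⟩
  · obtain ⟨h0, h⟩ := (sends_iff (represents_iter_recurrenceMap n)
      (iter_recurrenceMap_zero_ne_zero n) (isRelPrime_iter_recurrenceMap hc n).1).mp h
    have h2 : eval R.1.rep (iter (recurrenceMap m c) n 2) ≠ 0 := fun h2 => hR.1 <| by
      obtain ⟨a, -, ha⟩ := mk_rep_eq_smul h0
      simp [h, ha, h2]
    refine ⟨h2, ?_, hR⟩
    rw [← chart_coords hR.1, h, coords_mk h0]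
    rfl
  · rw [h.2.1]
    exact sends_chart_imageCoords (represents_iter_recurrenceMap n) h.1

variable (m c n) in
/-- The functions on `branchGraph m c n` that are integral over the functions on the base
`branchSet m c n`. -/
def integralAlgebra : Subalgebra k (branchGraph m c n → k) :=
  (integralClosure (pullbackAlgebra (plane k) Prod.snd (branchGraph m c n) (branchSet m c n))
    (branchGraph m c n → k)).restrictScalars k

lemma mem_integralAlgebra_of_sq_mem {f : branchGraph m c n → k}
    (hf : f ^ 2 ∈ integralAlgebra m c n) : f ∈ integralAlgebra m c n :=
  IsIntegral.of_pow two_pos hf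

lemma comp_snd_mem_integralAlgebra {a : P2 k → k} (ha : (plane k).RegularOn (branchSet m c n) a) :
    (fun R : branchGraph m c n => a R.1.2) ∈ integralAlgebra m c n :=
  isIntegral_algebraMap (R := pullbackAlgebra (plane k) Prod.snd (branchGraph m c n)
    (branchSet m c n)) (x := ⟨_, mem_pullbackAlgebra.mpr ⟨a, ha, rfl⟩⟩)

lemma orbitCoords_mem_integralAlgebra (hi : i ≤ n) :
    (∀ j, (fun R : branchGraph m c n => orbitCoords m c i R.1.1 j) ∈ integralAlgebra m c n) ∧
      (fun R : branchGraph m c n => (eval (orbitCoords m c i R.1.1) (branchPoly m c i))⁻¹) ∈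
        integralAlgebra m c n := by
  have hreg (j : Fin 2) := regularOn_coords (T := branchSet m c n) (fun _ hQ => hQ.1) j
  have hsnd (R : branchGraph m c n) := coords_snd_of_mem_branchGraph R.2
  refine orbitCoords_mem (B := integralAlgebra m c n) (p := fun R : branchGraph m c n => R.1.1)
    (fun _ hf => mem_integralAlgebra_of_sq_mem hf) (fun R => R.2.1)
    (fun R => eval_orbitCoords_ne_zero_of_mem_branchGraph R.2 le_rfl) (fun j => ?_) ?_ hi
  · simpa only [hsnd] using comp_snd_mem_integralAlgebra (hreg j)
  · simpa only [hsnd] using comp_snd_mem_integralAlgebra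
      ((Basics.RegularOn.eval hreg (branchPoly m c n)).inv fun _ hQ => hQ.2)

lemma inv_orbitCoords_one_mem_integralAlgebra (hi : i ≤ n) :
    (fun R : branchGraph m c n => (orbitCoords m c i R.1.1 1)⁻¹) ∈ integralAlgebra m c n := by
  obtain ⟨hmem, hinv⟩ := orbitCoords_mem_integralAlgebra (m := m) (c := c) hi
  obtain ⟨G, hG⟩ := exists_branchPoly_eq_mul (m := m) (c := c) i
  convert (integralAlgebra m c n).mul_mem (eval_mem_of_forall_mem hmem ((X 0 + C c) * G)) hinv
    using 1
  funext R
  have hR := eval_orbitCoords_ne_zero_of_mem_branchGraph R.2 hi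
  rw [hG, mul_assoc, map_mul, eval_X] at hR
  rw [Pi.mul_apply, hG, mul_assoc (X 1), map_mul (eval _) (X 1), eval_X, mul_inv, mul_left_comm,
    mul_inv_cancel₀ (right_ne_zero_of_mul hR), mul_one]

lemma rep_two_ne_zero_of_mem_branchGraph (hR : R ∈ branchGraph m c n) : R.1.rep 2 ≠ 0 := by
  simpa [iter] using eval_iter_two_ne_zero_of_le n.zero_le hR.1

lemma orbitCoords_chart (z : Fin 2 → k) :
    orbitCoords m c n (chart z) =
      ![eval ![z 0, z 1, 1] (iter (recurrenceMap m c) n 0) /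
          eval ![z 0, z 1, 1] (iter (recurrenceMap m c) n 2),
        eval ![z 0, z 1, 1] (iter (recurrenceMap m c) n 1) /
          eval ![z 0, z 1, 1] (iter (recurrenceMap m c) n 2)] :=
  imageCoords_chart (isHomogeneous_iter_recurrenceMap n) z

lemma inv_eval_iter_two_mem_integralAlgebra (hi : i ≤ n) :
    (fun R : branchGraph m c n =>
      (eval ![coords R.1.1 0, coords R.1.1 1, 1] (iter (recurrenceMap m c) i 2))⁻¹) ∈
        integralAlgebra m c n := by
  induction i with
  | zero =>
    simp only [iter, eval_X, Matrix.cons_val, inv_one]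
    exact (integralAlgebra m c n).one_mem
  | succ i ih =>
    have hi' : i ≤ n := (Nat.le_succ i).trans hi
    convert (integralAlgebra m c n).mul_mem
      (pow_mem (inv_orbitCoords_one_mem_integralAlgebra hi') 2) (pow_mem (ih hi') (m + 3)) using 1
    funext R
    rw [Pi.mul_apply, Pi.pow_apply, Pi.pow_apply,
      ← chart_coords (rep_two_ne_zero_of_mem_branchGraph R.2), orbitCoords_chart, coords_chart]
    simp only [iter_recurrenceMap_succ, Matrix.cons_val, map_mul, map_pow]
    generalize eval ![coords R.1.1 0, coords R.1.1 1, 1] (iter (recurrenceMap m c) i 2) = y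
    rcases eq_or_ne y 0 with rfl | hy
    · simp
    · rw [inv_pow, inv_pow y, ← mul_inv]
      congr 1
      field_simp
      ring

lemma exists_eval_eq_pow_mul_branchPoly : ∃ (K : MvPolynomial (Fin 2) k) (M : ℕ), ∀ z,
    eval z K = eval ![z 0, z 1, 1] (iter (recurrenceMap m c) n 2) ^ (M + 1) *
      eval (orbitCoords m c n (chart z)) (branchPoly m c n) := by
  let D (j : Fin 3) : MvPolynomial (Fin 2) k :=
    bind₁ ![X 0, X 1, 1] (iter (recurrenceMap m c) n j)
  have hD (z : Fin 2 → k) (j : Fin 3) :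
      eval z (D j) = eval ![z 0, z 1, 1] (iter (recurrenceMap m c) n j) := by
    rw [eval_bind₁]
    congr 2
    funext i
    fin_cases i <;> simp
  obtain ⟨G, M, hG⟩ :=
    exists_clear_denominator (fun i : Fin 2 => D i.castSucc) (D 2) (branchPoly m c n)
  simp only [hD] at hG
  refine ⟨D 2 * G, M, fun z => ?_⟩
  rw [map_mul, hD]
  rcases eq_or_ne (eval ![z 0, z 1, 1] (iter (recurrenceMap m c) n 2)) 0 with h | h
  · simp [h]
  · rw [hG z h, pow_succ', mul_assoc, orbitCoords_chart]
    congr 4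
    funext i
    fin_cases i <;> rfl

lemma chart_prod_mem_branchGraph {z : Fin 2 → k} :
    (chart z, chart (orbitCoords m c n (chart z))) ∈ branchGraph m c n ↔
      eval ![z 0, z 1, 1] (iter (recurrenceMap m c) n 2) ≠ 0 ∧
        eval (orbitCoords m c n (chart z)) (branchPoly m c n) ≠ 0 := by
  obtain ⟨a, ha, h⟩ := chart_rep z
  simp only [branchGraph, Set.mem_ofPred_eq, chart_mem_branchSet, h,
    eval_smul_of_isHomogeneous (isHomogeneous_iter_recurrenceMap n 2), true_and, ne_eq,
    mul_eq_zero, pow_eq_zero_iff', ha, false_and, false_or]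

lemma isFiniteMorphism_snd_branchGraph [IsAlgClosed k] :
    IsFiniteMorphism (planeSq k) (plane k) Prod.snd (branchGraph m c n) (branchSet m c n) := by
  obtain ⟨K, M, hK⟩ := exists_eval_eq_pow_mul_branchPoly (m := m) (c := c) (n := n)
  have hmem {z : Fin 2 → k} : z ∈ principalOpen K ↔
      (chart z, chart (orbitCoords m c n (chart z))) ∈ branchGraph m c n := by
    rw [chart_prod_mem_branchGraph, principalOpen, Set.mem_ofPred_eq, hK, mul_ne_zero_iff,
      pow_ne_zero_iff M.succ_ne_zero]
  have hchart {R : P2 k × P2 k} (hR : R ∈ branchGraph m c n) :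
      (chart (coords R.1), chart (orbitCoords m c n (chart (coords R.1)))) = R := by
    rw [chart_coords (rep_two_ne_zero_of_mem_branchGraph hR), ← hR.2.1]
  have hreg (j : Fin 2) : (affineSpace k 2).RegularOn (principalOpen K)
      fun z => orbitCoords m c n (chart z) j :=
    (isMorphism_chart (Basics.regularOn_coord _) fun z hz => (hmem.mp hz).1).comp_regularOn
      (regularOn_imageCoords (isHomogeneous_iter_recurrenceMap n) (fun _ h => h) j)
  have hu : IsMorphism (planeSq k) (affineSpace k 2) (fun R => coords R.1) (branchGraph m c n)
      (principalOpen K) :=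
    isMorphism_affineSpace (fun R hR => hmem.mpr ((hchart hR).symm ▸ hR)) fun j =>
      (isMorphism_fst fun _ => rep_two_ne_zero_of_mem_branchGraph).comp_regularOn
        (regularOn_coords (fun _ h => h) j)
  refine isFiniteMorphism_of_isIntegral (isMorphism_snd fun _ hR => hR.2.2) isAffine_branchSet hu
    (isMorphism_chart_prod (Basics.regularOn_coord _) hreg fun _ => hmem.mp) (fun _ => hchart)
    (fun z _ => coords_chart z) (orbitCoords_mem_integralAlgebra n.zero_le).1 ?_
  have hinv : (fun R : branchGraph m c n => (eval (coords R.1.1) K)⁻¹) ∈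
      integralAlgebra m c n := by
    convert (integralAlgebra m c n).mul_mem
      (pow_mem (inv_eval_iter_two_mem_integralAlgebra le_rfl) (M + 1))
      (orbitCoords_mem_integralAlgebra le_rfl).2 using 1
    funext R
    rw [hK, chart_coords (rep_two_ne_zero_of_mem_branchGraph R.2), mul_inv, ← inv_pow]
    rfl
  exact hinv

lemma rep_two_ne_zero_of_mem_closure (hR : R ∈ @closure _ (planeSq k).top (branchGraph m c n))
    (hR2 : R.2 ∈ branchSet m c n) : R.1.rep 2 ≠ 0 := fun h => by
  have hX (j : Fin 3) (hj : (fun R : branchGraph m c n => R.1.1.rep j / R.1.1.rep 2) ∈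
      integralAlgebra m c n) : R.1.rep j = 0 := by
    have hintegral : IsIntegral (pullbackAlgebra (plane k) Prod.snd (branchGraph m c n)
        (branchSet m c n)) fun R : branchGraph m c n =>
          eval R.1.1.rep (X j) / eval R.1.1.rep (X 2) := by
      simp only [eval_X]
      exact hj
    rw [← eval_X (f := R.1.rep)]
    exact eval_eq_zero_of_isIntegral_of_mem_closure (isHomogeneous_X k j) (isHomogeneous_X k 2)
      (fun R hR => by rw [eval_X]; exact rep_two_ne_zero_of_mem_branchGraph hR) isOpen_branchSet
      hintegral hR2 hR (by rwa [eval_X])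
  have hmem := (orbitCoords_mem_integralAlgebra (m := m) (c := c) n.zero_le).1
  refine R.1.rep_nonzero (funext fun j => ?_)
  fin_cases j
  · exact hX 0 (by simpa [iter, imageCoords] using hmem 0)
  · exact hX 1 (by simpa [iter, imageCoords] using hmem 1)
  · exact h

lemma eval_iter_two_ne_zero_of_mem_closure (hi : i ≤ n)
    (hR : R ∈ @closure _ (planeSq k).top (branchGraph m c n)) (hR2 : R.2 ∈ branchSet m c n) :
    eval R.1.rep (iter (recurrenceMap m c) i 2) ≠ 0 := by
  induction i with
  | zero => simpa [iter] using rep_two_ne_zero_of_mem_closure hR hR2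
  | succ i ih =>
    have hi' : i ≤ n := (Nat.le_succ i).trans hi
    refine eval_iter_succ_two_ne_zero.mpr ⟨fun h => ih hi' ?_, ih hi'⟩
    refine eval_eq_zero_of_isIntegral_of_mem_closure (isHomogeneous_iter_recurrenceMap i 2)
      (isHomogeneous_iter_recurrenceMap i 1) (fun R hR => ?_) isOpen_branchSet ?_ hR2 hR h
    · exact (eval_iter_succ_two_ne_zero.mp (eval_iter_two_ne_zero_of_le hi hR.1)).1
    · have hinv := inv_orbitCoords_one_mem_integralAlgebra (m := m) (c := c) hi'
      simp only [imageCoords, Matrix.cons_val, inv_div] at hinv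
      exact hinv

lemma mem_closure_branchGraph (hc : c ≠ 0) (hR : R ∈ graph (iter (recurrenceMap m c) n))
    (hR2 : R.2 ∈ branchSet m c n) : R ∈ @closure _ (planeSq k).top (branchGraph m c n) := by
  refine (@mem_closure_iff _ (planeSq k).top _ _).mpr fun O hO hRO => ?_
  obtain ⟨R', ⟨hR'O, -, hR'2⟩, hR'⟩ := (@mem_closure_iff _ (planeSq k).top _ _).mp hR _
    (@IsOpen.inter _ (planeSq k).top _ _ hO
      (isOpen_fst_inter_snd (@isOpen_univ _ (plane k).top) isOpen_branchSet))
    ⟨hRO, Set.mem_univ _, hR2⟩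
  exact ⟨R', hR'O, (sends_iff_mem_branchGraph hc hR'2).mp hR'⟩

lemma coords_snd_of_mem_closure (hR : R ∈ @closure _ (planeSq k).top (branchGraph m c n))
    (hR2 : R.2 ∈ branchSet m c n) : coords R.2 = orbitCoords m c n R.1 := funext fun j => by
  have hhom := isHomogeneous_iter_recurrenceMap (m := m) (c := c) n
  set U := {R : P2 k × P2 k | R.1 ∈ {P : P2 k | eval P.rep (iter (recurrenceMap m c) n 2) ≠ 0} ∧
    R.2 ∈ branchSet m c n}
  have hsnd : (planeSq k).RegularOn U fun R => coords R.2 j :=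
    (isMorphism_snd fun _ hR => hR.2.1).comp_regularOn (regularOn_coords (fun _ h => h) j)
  have hfst : (planeSq k).RegularOn U fun R => orbitCoords m c n R.1 j :=
    (isMorphism_fst fun _ hR => hR.1).comp_regularOn (regularOn_imageCoords hhom (fun _ h => h) j)
  have hsub : (planeSq k).RegularOn U fun R => coords R.2 j - orbitCoords m c n R.1 j :=
    ((planeSq k).regularAlgebra U).sub_mem hsnd hfst
  have hU : IsOpen[(planeSq k).top] U :=
    isOpen_fst_inter_snd (isOpen_eval_rep_ne_zero (hhom 2)) isOpen_branchSet
  have hRU : R ∈ U := ⟨eval_iter_two_ne_zero_of_mem_closure le_rfl hR hR2, hR2⟩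
  have hzero := Basics.RegularOn.eq_zero_of_mem_closure hU hsub hRU hR
    fun R hR _ => by rw [coords_snd_of_mem_branchGraph hR, sub_self]
  exact sub_eq_zero.mp hzero

lemma graph_inter_preimage_branchSet (hc : c ≠ 0) :
    graph (iter (recurrenceMap m c) n) ∩ Prod.snd ⁻¹' branchSet m c n = branchGraph m c n := by
  ext R
  refine ⟨fun ⟨hR, hR2⟩ => ?_, fun hR =>
    ⟨@subset_closure _ (planeSq k).top _ _ ((sends_iff_mem_branchGraph hc hR.2.2).mpr hR),
      hR.2.2⟩⟩
  have hcl := mem_closure_branchGraph hc hR hR2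
  exact ⟨eval_iter_two_ne_zero_of_mem_closure le_rfl hcl hR2,
    by rw [← coords_snd_of_mem_closure hcl hR2, chart_coords hR2.1], hR2⟩

lemma finiteOver_branchSet [IsAlgClosed k] (hc : c ≠ 0) :
    FiniteOver (iter (recurrenceMap m c) n) (branchSet m c n) := by
  refine ⟨?_, fun R hR hR2 hind => hind ⟨R.2, ?_⟩⟩
  · rw [graph_inter_preimage_branchSet hc]
    exact isFiniteMorphism_snd_branchGraph
  · exact (sends_iff_mem_branchGraph hc hR2).mpr
      ((graph_inter_preimage_branchSet hc).subset ⟨hR, hR2⟩)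

lemma chart_mem_backLocus [IsAlgClosed k] (hc : c ≠ 0) {z : Fin 2 → k}
    (hz : ∀ n, eval z (branchPoly m c n) ≠ 0) : chart z ∈ backLocus (recurrenceMap m c) :=
  fun n _ => ⟨branchSet m c n, isOpen_branchSet, chart_mem_branchSet.mpr (hz n),
    finiteOver_branchSet hc⟩

end BranchGraph

/-! ### Backward orbits -/

section BackwardOrbit

variable {k : Type*} [Field k] {m : ℕ} {c : k} {v : AbsoluteValue k ℝ} {r : ℝ} {w z : Fin 2 → k}

lemma absoluteValue_add_eq_of_lt (hv : IsNonarchimedean v) {a b : k} (h : v a < v b) :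
    v (a + b) = v b := by
  rw [IsNonarchimedean.add_eq_max_of_ne' v hv (fun a => (v.map_neg a).symm) h.ne, max_eq_right h.le]

lemma exists_padic_absoluteValue [Algebra ℚ k] [Algebra.IsAlgebraic ℚ k] (p : ℕ) [Fact p.Prime] :
    ∃ v : AbsoluteValue k ℝ, IsNonarchimedean v ∧ v p = (p : ℝ)⁻¹ := by
  let φ : k →ₐ[ℚ] PadicAlgCl p := IsAlgClosed.lift
  refine ⟨(NormedField.toAbsoluteValue (PadicAlgCl p)).comp φ.injective, fun a b => ?_, ?_⟩
  · change ‖φ (a + b)‖ ≤ max ‖φ a‖ ‖φ b‖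
    rw [map_add]
    exact PadicAlgCl.isNonarchimedean p _ _
  · have hnorm := PadicAlgCl.norm_extends p (p : ℚ_[p])
    rw [map_natCast, Padic.norm_p] at hnorm
    change ‖φ p‖ = _
    rw [map_natCast, hnorm]

lemma absoluteValue_fixedPoint (hv : IsNonarchimedean v) (hm : m ≠ 0) (hc : 1 < v c) {α : k}
    (hα : α ^ (m + 1) = α + c) : v α < v c ∧ v α ^ (m + 1) = v c := by
  have hcα : c = -α + α ^ (m + 1) := by rw [hα]; ring
  have hα1 : 1 < v α := by
    by_contra! hle
    refine hc.not_ge ?_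
    rw [hcα]
    refine (hv _ _).trans (max_le (by rwa [v.map_neg]) ?_)
    rw [map_pow]
    exact pow_le_one₀ (v.nonneg _) hle
  have hlt : v α < v α ^ (m + 1) := lt_self_pow₀ hα1 (by omega)
  have heq : v c = v α ^ (m + 1) := by
    rw [hcα, absoluteValue_add_eq_of_lt hv (by rwa [v.map_neg, map_pow]), map_pow]
  exact ⟨heq ▸ hlt, heq.symm⟩

lemma absoluteValue_ne_zero_of_pow_eq (hrc : r < v c) (hr : r ^ (m + 1) = v c) : r ≠ 0 := by
  rintro rfl
  rw [zero_pow m.succ_ne_zero] at hr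
  exact hrc.ne hr

lemma add_ne_zero_of_absoluteValue_lt {a : k} (h : v a < v c) : a + c ≠ 0 := fun h0 => by
  rw [eq_neg_of_add_eq_zero_left h0, v.map_neg] at h
  exact h.false

lemma IsPreimage.absoluteValue_eq (hv : IsNonarchimedean v) (hrc : r < v c)
    (hr : r ^ (m + 1) = v c) (h0 : v (w 0) = r) (h1 : v (w 1) = r) (h : IsPreimage m c w z) :
    v (z 1) = r := by
  have hr0 : 0 ≤ r := h0 ▸ v.nonneg _
  have hrel := congrArg v h.2
  rw [map_mul, map_pow, map_pow, absoluteValue_add_eq_of_lt hv (h0 ▸ hrc), h1,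
    show m + 3 = m + 1 + 2 from rfl, pow_add, hr] at hrel
  exact (pow_left_inj₀ (v.nonneg _) hr0 two_ne_zero).mp
    (mul_left_cancel₀ (hr0.trans_lt hrc).ne' hrel)

lemma eval_branchPoly_ne_zero_of_absoluteValue [IsAlgClosed k] (hv : IsNonarchimedean v)
    (hrc : r < v c) (hr : r ^ (m + 1) = v c) (n : ℕ) (h0 : v (w 0) = r) (h1 : v (w 1) = r) :
    eval w (branchPoly m c n) ≠ 0 := by
  have hw1 : w 1 ≠ 0 := v.ne_zero_iff.mp (h1 ▸ absoluteValue_ne_zero_of_pow_eq hrc hr)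
  have hw0 : w 0 + c ≠ 0 := add_ne_zero_of_absoluteValue_lt (h0 ▸ hrc)
  induction n generalizing w with
  | zero => simpa [branchPoly] using ⟨hw1, hw0⟩
  | succ n ih =>
    refine eval_branchPoly_succ_ne_zero hw1 hw0 fun z hz => ?_
    have hz0 : v (z 0) = r := by rw [hz.1, h1]
    have hz1 : v (z 1) = r := hz.absoluteValue_eq hv hrc hr h0 h1
    exact ih hz0 hz1 (v.ne_zero_iff.mp (hz1 ▸ absoluteValue_ne_zero_of_pow_eq hrc hr))
      (add_ne_zero_of_absoluteValue_lt (hz0 ▸ hrc))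

/-- Two consecutive terms of a sequence: the affine coordinates of the `j`-th point of the backward
orbit which the sequence describes. -/
def window (a : ℕ → k) (j : ℕ) : Fin 2 → k := ![a j, a (j + 1)]

lemma exists_isPreimage [IsAlgClosed k] (h : w 0 + c ≠ 0) :
    ∃ t, IsPreimage m c w ![w 1, t] := by
  obtain ⟨t, ht⟩ := IsAlgClosed.exists_pow_nat_eq (w 1 ^ (m + 3) / (w 0 + c)) two_pos
  exact ⟨t, rfl, by simp [ht, mul_div_cancel₀ _ h]⟩

lemma exists_backward_sequence [IsAlgClosed k] (hv : IsNonarchimedean v) (hrc : r < v c)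
    (hr : r ^ (m + 1) = v c) (h0 : v (w 0) = r) (h1 : v (w 1) = r) :
    ∃ a : ℕ → k, window a 0 = w ∧ (∀ j, v (a j) = r) ∧
      ∀ j, IsPreimage m c (window a j) (window a (j + 1)) := by
  let S := {u : Fin 2 → k // v (u 0) = r ∧ v (u 1) = r}
  have hstep : ∀ u : S, ∃ u' : S, IsPreimage m c u.1 u'.1 := fun ⟨u, hu0, hu1⟩ => by
    obtain ⟨t, ht⟩ := exists_isPreimage (m := m) (add_ne_zero_of_absoluteValue_lt (hu0 ▸ hrc))
    exact ⟨⟨![u 1, t], hu1, ht.absoluteValue_eq hv hrc hr hu0 hu1⟩, ht⟩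
  choose next hnext using hstep
  let u : ℕ → S := fun j => next^[j] ⟨w, h0, h1⟩
  have hu : ∀ j, IsPreimage m c (u j).1 (u (j + 1)).1 := fun j => by
    simp only [u, Function.iterate_succ_apply']
    exact hnext _
  have hwindow : window (fun j => (u j).1 0) = fun j => (u j).1 := by
    funext j i
    fin_cases i
    exacts [rfl, (hu j).1]
  refine ⟨fun j => (u j).1 0, congrFun hwindow 0, fun j => (u j).2.1, fun j => ?_⟩
  rw [hwindow]
  exact hu j

lemma notMem_indet {F : Triple k} {P Q : P2 k} (h : Sends F P Q) : P ∉ indet F :=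
  fun hP => hP ⟨Q, h⟩

lemma sends_chart_of_isPreimage (h : IsPreimage m c w z) (hz : z 1 ≠ 0) :
    Sends (recurrenceMap m c) (chart z) (chart w) := by
  have heval : (fun i => eval ![z 0, z 1, 1] (recurrenceMap m c i)) = z 1 ^ 2 • ![w 0, w 1, 1] := by
    rw [eval_recurrenceMap]
    funext i
    fin_cases i
    · simp [h.1]
      linear_combination -h.2
    · simp [h.1, mul_comm]
    · simp
  have hne : (fun i => eval ![z 0, z 1, 1] (recurrenceMap m c i)) ≠ 0 := fun h0 => by
    simpa [hz] using congrFun (heval.symm.trans h0) 2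
  have hchart : Projectivization.mk k _ hne = chart w := by
    rw [chart, Projectivization.mk_eq_mk_iff']
    exact ⟨z 1 ^ 2, heval.symm⟩
  exact hchart ▸ sends_mk represents_recurrenceMap _ hne

end BackwardOrbit

/-! ### Growth of the `3`-adic absolute values -/

section Growth

/-- The solution of `e (n + 2) = 2 * e (n + 1) - e n / 2` with `e 0 = 1 / 4` and `e 1 = 1 / 2`; the
roots of the characteristic polynomial are `1 ± √2 / 2`. These are the growth exponents of the
`3`-adic absolute values along the backward orbit. -/
def orbitExponent (n : ℕ) : ℝ :=
  ((1 + √2) * (1 + √2 / 2) ^ n + (1 - √2) * (1 - √2 / 2) ^ n) / 8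

lemma orbitExponent_zero : orbitExponent 0 = 1 / 4 := by
  simp only [orbitExponent, pow_zero]
  ring

lemma orbitExponent_one : orbitExponent 1 = 1 / 2 := by
  have h : √2 ^ 2 = 2 := Real.sq_sqrt (by norm_num)
  simp only [orbitExponent, pow_one]
  linear_combination h / 8

lemma orbitExponent_add_two (n : ℕ) :
    orbitExponent (n + 2) = 2 * orbitExponent (n + 1) - orbitExponent n / 2 := by
  have h : √2 ^ 2 = 2 := Real.sq_sqrt (by norm_num)
  simp only [orbitExponent, pow_succ]
  linear_combination ((1 + √2) * (1 + √2 / 2) ^ n + (1 - √2) * (1 - √2 / 2) ^ n) / 32 * h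

lemma orbitExponent_growth (n : ℕ) :
    0 < orbitExponent n ∧ 3 / 2 * orbitExponent n ≤ orbitExponent (n + 1) := by
  induction n with
  | zero => rw [orbitExponent_zero, zero_add, orbitExponent_one]; norm_num
  | succ n ih =>
    rw [orbitExponent_add_two]
    constructor <;> linarith

lemma tendsto_orbitExponent : Tendsto orbitExponent atTop atTop := by
  have h : ∀ n, (3 / 2 : ℝ) ^ n * orbitExponent 0 ≤ orbitExponent n :=
    fun n => geom_le (by norm_num) n fun j _ => (orbitExponent_growth j).2
  refine tendsto_atTop_mono h (Tendsto.atTop_mul_const (orbitExponent_growth 0).1 ?_)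
  exact tendsto_pow_atTop_atTop_of_one_lt (by norm_num)

lemma tendsto_abs_add_geometric {κ η x y : ℝ} (hκ : κ ≠ 0) (hx : 1 < x) (hy : |y| ≤ 1) :
    Tendsto (fun n : ℕ => |κ * x ^ n + η * y ^ n|) atTop atTop := by
  have hlow : ∀ n : ℕ, |κ| * x ^ n + -|η| ≤ |κ * x ^ n + η * y ^ n| := fun n => by
    have hη : |η * y ^ n| ≤ |η| := by
      rw [abs_mul, abs_pow]
      exact mul_le_of_le_one_right (abs_nonneg _) (pow_le_one₀ (abs_nonneg _) hy)
    calc |κ| * x ^ n + -|η| ≤ |κ * x ^ n| - |η * y ^ n| := by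
          rw [abs_mul, abs_of_pos (pow_pos (one_pos.trans hx) n)]
          linarith
      _ ≤ |κ * x ^ n + η * y ^ n| := by
          simpa using abs_sub_abs_le_abs_sub (κ * x ^ n) (-(η * y ^ n))
  refine tendsto_atTop_mono hlow (tendsto_atTop_add_const_right _ _ ?_)
  exact (tendsto_pow_atTop_atTop_of_one_lt hx).const_mul_atTop (abs_pos.mpr hκ)

lemma int_add_int_mul_irrational_ne_zero {x : ℝ} (hx : Irrational x) {a b : ℤ}
    (h : a ≠ 0 ∨ b ≠ 0) : (a : ℝ) + b * x ≠ 0 := by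
  rcases eq_or_ne b 0 with rfl | hb
  · simpa using h
  · exact ((hx.intCast_mul hb).intCast_add a).ne_zero

lemma tendsto_abs_linear_orbitExponent {a b : ℤ} (h : a ≠ 0 ∨ b ≠ 0) :
    Tendsto (fun n => |a * orbitExponent n + b * orbitExponent (n + 1)|) atTop atTop := by
  have hsqrt0 : 0 < √2 := by positivity
  have hsqrt2 : √2 < 2 := by
    rw [Real.sqrt_lt' (by norm_num)]
    norm_num
  have hirr : Irrational (1 + √2 / 2) := by
    simpa using (irrational_sqrt_two.div_natCast (m := 2) two_ne_zero).natCast_add 1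
  have hκ : (1 + √2) * (a + b * (1 + √2 / 2)) / 8 ≠ 0 :=
    div_ne_zero (mul_ne_zero (by positivity) (int_add_int_mul_irrational_ne_zero hirr h))
      (by norm_num)
  have hx : 1 < 1 + √2 / 2 := by linarith
  have hy : |1 - √2 / 2| ≤ 1 := abs_le.mpr ⟨by linarith, by linarith⟩
  refine (tendsto_abs_add_geometric (η := (1 - √2) * (a + b * (1 - √2 / 2)) / 8) hκ hx hy).congr
    fun n => ?_
  simp only [orbitExponent, pow_succ]
  ring_nf

variable {k : Type*} [Field k] {m : ℕ} {c : k} {v : AbsoluteValue k ℝ} {w z : Fin 2 → k}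

lemma IsPreimage.log_absoluteValue_eq (h : IsPreimage m c w z) (hw1 : w 1 ≠ 0) :
    Real.log (v (z 1)) = ((m + 3) * Real.log (v (w 1)) - Real.log (v (w 0 + c))) / 2 := by
  have hrel := congrArg v h.2
  rw [map_mul, map_pow, map_pow] at hrel
  have hprod : v (w 0 + c) * v (z 1) ^ 2 ≠ 0 := hrel ▸ pow_ne_zero _ (v.ne_zero hw1)
  have hlog := congrArg Real.log hrel
  rw [Real.log_mul (left_ne_zero_of_mul hprod) (right_ne_zero_of_mul hprod), Real.log_pow,
    Real.log_pow] at hlog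
  push_cast at hlog
  linarith

lemma log_absoluteValue_eq_orbitExponent (hv : IsNonarchimedean v) (hc : v c ≤ 1) {ℓ : ℝ}
    (hℓ : 0 < ℓ) {a : ℕ → k} (h0 : Real.log (v (a 0)) = orbitExponent 0 * ℓ)
    (h1 : Real.log (v (a 1)) = orbitExponent 1 * ℓ) {n : ℕ}
    (h : ∀ j < n, IsPreimage 1 c (window a j) (window a (j + 1))) :
    Real.log (v (a n)) = orbitExponent n * ℓ ∧
      Real.log (v (a (n + 1))) = orbitExponent (n + 1) * ℓ := by
  induction n with
  | zero => exact ⟨h0, h1⟩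
  | succ n ih =>
    obtain ⟨hn, hn1⟩ := ih fun j hj => h j (hj.trans n.lt_succ_self)
    have one_lt : ∀ j, Real.log (v (a j)) = orbitExponent j * ℓ → 1 < v (a j) := fun j hj =>
      (Real.log_pos_iff (v.nonneg _)).mp (hj ▸ mul_pos (orbitExponent_growth j).1 hℓ)
    have hadd : v (a n + c) = v (a n) := by
      rw [add_comm, absoluteValue_add_eq_of_lt hv (hc.trans_lt (one_lt n hn))]
    have hlog := (h n n.lt_succ_self).log_absoluteValue_eq (v := v)
      (v.ne_zero_iff.mp (one_pos.trans (one_lt _ hn1)).ne')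
    refine ⟨hn1, ?_⟩
    simp only [window, Matrix.cons_val_zero, Matrix.cons_val_one, hadd, hn, hn1] at hlog
    rw [hlog, orbitExponent_add_two]
    push_cast
    ring

variable {α : k}

lemma absoluteValue_two_eq_one (hv : IsNonarchimedean v) (h3 : v 3 < 1) : v 2 = 1 := by
  have h1 : v (-1) = 1 := by rw [v.map_neg, map_one]
  rw [show (2 : k) = 3 + -1 by norm_num, absoluteValue_add_eq_of_lt hv (h3.trans_eq h1.symm), h1]

lemma absoluteValue_sqrt_three_sq (h2 : (2 : k) ≠ 0) (hα : α ^ 2 = α + 1 / 2) :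
    v (2 * α - 1) ^ 2 = v 3 := by
  rw [← map_pow]
  congr 1
  field_simp at hα
  linear_combination 2 * hα

lemma absoluteValue_root_add_half (hv : IsNonarchimedean v) (h3 : v 3 < 1)
    (hα : α ^ 2 = α + 1 / 2) : v (α + 1 / 2) = 1 ∧ v α = 1 := by
  have hv2 := absoluteValue_two_eq_one hv h3
  have h2 : (2 : k) ≠ 0 := v.ne_zero_iff.mp (hv2.trans_ne one_ne_zero)
  have hs : v (2 * α - 1) < 1 := lt_of_pow_lt_pow_left₀ 2 zero_le_one (by
    rwa [absoluteValue_sqrt_three_sq h2 hα, one_pow])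
  have hhalf : v (α + 1 / 2) = 1 := by
    rw [show α + 1 / 2 = (2 * α - 1 + 2) / 2 by field_simp; ring, map_div₀,
      absoluteValue_add_eq_of_lt hv (hs.trans_eq hv2.symm), hv2, div_one]
  refine ⟨hhalf, (pow_eq_one_iff_of_nonneg (v.nonneg _) two_ne_zero).mp ?_⟩
  rw [← map_pow, hα, hhalf]

lemma absoluteValue_half_sub_root (hv : IsNonarchimedean v) (h3 : v 3 < 1)
    (hα : α ^ 2 = α + 1 / 2) : v (-α + 1 / 2) ^ 2 = v 3 := by
  have hv2 := absoluteValue_two_eq_one hv h3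
  have h2 : (2 : k) ≠ 0 := v.ne_zero_iff.mp (hv2.trans_ne one_ne_zero)
  rw [show -α + 1 / 2 = -((2 * α - 1) / 2) by field_simp; ring, v.map_neg, map_div₀, hv2, div_one,
    absoluteValue_sqrt_three_sq h2 hα]

lemma log_absoluteValue_backward_sequence (hv : IsNonarchimedean v) (h3 : v 3 < 1)
    (h30 : (3 : k) ≠ 0) {a : ℕ → k} (ha0 : a 0 = -a 1) (ha1 : a 1 ^ 2 = a 1 + 1 / 2) {n : ℕ}
    (h : ∀ j < n + 2, IsPreimage 1 (1 / 2) (window a j) (window a (j + 1))) :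
    Real.log (v (a (n + 2))) = orbitExponent n * -Real.log (v 3) ∧
      Real.log (v (a (n + 3))) = orbitExponent (n + 1) * -Real.log (v 3) := by
  obtain ⟨hadd, hroot⟩ := absoluteValue_root_add_half hv h3 ha1
  have hsub := absoluteValue_half_sub_root hv h3 ha1
  have hℓ : 0 < -Real.log (v 3) := neg_pos.mpr (Real.log_neg (v.pos h30) h3)
  have hlogsub := congrArg Real.log hsub
  rw [Real.log_pow] at hlogsub
  push_cast at hlogsub
  have hlog2 : Real.log (v (a 2)) = orbitExponent 0 * -Real.log (v 3) := by
    have hlog := (h 0 (by omega)).log_absoluteValue_eq (v := v)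
      (v.ne_zero_iff.mp (hroot.trans_ne one_ne_zero))
    simp only [window, Matrix.cons_val_zero, Matrix.cons_val_one, ha0, hroot, Real.log_one] at hlog
    rw [orbitExponent_zero]
    linarith
  have hlog3 : Real.log (v (a 3)) = orbitExponent 1 * -Real.log (v 3) := by
    have ha2 : a 2 ≠ 0 := fun h0 => by
      rw [h0, map_zero, Real.log_zero] at hlog2
      exact (mul_pos (orbitExponent_growth 0).1 hℓ).ne hlog2
    have hlog := (h 1 (by omega)).log_absoluteValue_eq (v := v) ha2
    simp only [window, Matrix.cons_val_zero, Matrix.cons_val_one, hadd, Real.log_one,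
      Nat.reduceAdd, hlog2] at hlog
    rw [hlog, orbitExponent_zero, orbitExponent_one]
    push_cast
    ring
  have hhalf : v (1 / 2) ≤ 1 := by
    rw [map_div₀, map_one, absoluteValue_two_eq_one hv h3, div_one]
  exact log_absoluteValue_eq_orbitExponent (a := fun j => a (j + 2)) hv hhalf hℓ hlog2 hlog3
    fun j hj => h (j + 2) (by omega)

end Growth

/-! ### Density and heights -/

section Density

variable {k : Type*} [Field k] {v : AbsoluteValue k ℝ}

lemma eval_ne_zero_of_injOn {σ : Type*} [Fintype σ] (hv : IsNonarchimedean v)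
    {B : MvPolynomial σ k} (hB : B ≠ 0) {z : σ → k} (hz : ∀ i, z i ≠ 0)
    (hinj : Set.InjOn (fun d : σ →₀ ℕ => v (coeff d B * ∏ i, z i ^ d i)) B.support) :
    eval z B ≠ 0 := by
  obtain ⟨d, hd, hmax⟩ := B.support.exists_max_image
    (fun d => v (coeff d B * ∏ i, z i ^ d i)) (support_nonempty.mpr hB)
  have hsum := IsNonarchimedean.apply_sum_eq_of_lt hv (fun a => (v.map_neg a).symm)
    (l := fun d => coeff d B * ∏ i, z i ^ d i) hd
    fun d' hd' hne => (hmax d' hd').lt_of_ne fun h => hne (hinj hd' hd h)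
  rw [eval_eq', ← v.ne_zero_iff, hsum, v.ne_zero_iff]
  exact mul_ne_zero (mem_support_iff.mp hd)
    (Finset.prod_ne_zero_iff.mpr fun i _ => pow_ne_zero _ (hz i))

lemma log_absoluteValue_monomial {a : k} (ha : a ≠ 0) {z : Fin 2 → k} (hz : ∀ i, z i ≠ 0)
    (d : Fin 3 →₀ ℕ) : Real.log (v (a * ∏ i, (![z 0, z 1, 1] : Fin 3 → k) i ^ d i)) =
      Real.log (v a) + (d 0 * Real.log (v (z 0)) + d 1 * Real.log (v (z 1))) := by
  have h0 := pow_ne_zero (d 0) (v.ne_zero (hz 0))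
  have h1 := pow_ne_zero (d 1) (v.ne_zero (hz 1))
  simp only [Fin.prod_univ_three, Matrix.cons_val, one_pow, mul_one, map_mul, map_pow]
  rw [Real.log_mul (v.ne_zero ha) (mul_ne_zero h0 h1), Real.log_mul h0 h1, Real.log_pow,
    Real.log_pow]

lemma eventually_monomial_ne {a a' : k} (ha : a ≠ 0) (ha' : a' ≠ 0) {z : ℕ → Fin 2 → k}
    (hz : ∀ n i, z n i ≠ 0) {d d' : Fin 3 →₀ ℕ}
    (h : Tendsto (fun n => |((d 0 - d' 0 : ℤ) : ℝ) * Real.log (v (z n 0)) +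
      ((d 1 - d' 1 : ℤ) : ℝ) * Real.log (v (z n 1))|) atTop atTop) :
    ∀ᶠ n in atTop, v (a * ∏ i, (![z n 0, z n 1, 1] : Fin 3 → k) i ^ d i) ≠
      v (a' * ∏ i, (![z n 0, z n 1, 1] : Fin 3 → k) i ^ d' i) := by
  filter_upwards [h.eventually_gt_atTop |Real.log (v a') - Real.log (v a)|] with n hn heq
  have hlog := congrArg Real.log heq
  rw [log_absoluteValue_monomial ha (hz n), log_absoluteValue_monomial ha' (hz n)] at hlog
  refine hn.ne (congrArg _ ?_)
  push_cast
  linear_combination -hlog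

lemma exists_ne_of_degree_eq {d d' : Fin 3 →₀ ℕ} (h : d.degree = d'.degree) (hne : d ≠ d') :
    (d 0 : ℤ) - d' 0 ≠ 0 ∨ (d 1 : ℤ) - d' 1 ≠ 0 := by
  contrapose! hne
  simp only [Finsupp.degree_eq_sum, Fin.sum_univ_three] at h
  ext i
  fin_cases i <;> simp <;> omega

lemma dense_range_chart (hv : IsNonarchimedean v) {z : ℕ → Fin 2 → k} (hz : ∀ n i, z n i ≠ 0)
    (h : ∀ {a b : ℤ}, a ≠ 0 ∨ b ≠ 0 →
      Tendsto (fun n => |a * Real.log (v (z n 0)) + b * Real.log (v (z n 1))|) atTop atTop) :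
    @Dense _ (plane k).top (Set.range fun n => chart (z n)) := by
  refine dense_of_forall_exists_eval_ne_zero fun e B hB hB0 => ?_
  have hev : ∀ᶠ n in atTop, ∀ d ∈ B.support, ∀ d' ∈ B.support, d ≠ d' →
      v (coeff d B * ∏ i, (![z n 0, z n 1, 1] : Fin 3 → k) i ^ d i) ≠
        v (coeff d' B * ∏ i, (![z n 0, z n 1, 1] : Fin 3 → k) i ^ d' i) := by
    simp only [eventually_all_finset, eventually_imp_distrib_left]
    intro d hd d' hd' hne
    have hdeg : d.degree = d'.degree := by
      rw [Finsupp.degree_eq_weight_one]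
      exact (hB (mem_support_iff.mp hd)).trans (hB (mem_support_iff.mp hd')).symm
    exact eventually_monomial_ne (mem_support_iff.mp hd) (mem_support_iff.mp hd') hz
      (h (exists_ne_of_degree_eq hdeg hne))
  obtain ⟨n, hn⟩ := hev.exists
  refine ⟨_, ⟨n, rfl⟩, ?_⟩
  obtain ⟨c, hc, hrep⟩ := chart_rep (z n)
  rw [hrep, eval_smul_of_isHomogeneous hB]
  refine mul_ne_zero (pow_ne_zero _ hc) (eval_ne_zero_of_injOn hv hB0 (fun i => ?_) ?_)
  · fin_cases i
    exacts [hz n 0, hz n 1, one_ne_zero]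
  · intro d hd d' hd' heq
    by_contra hne
    exact hn d hd d' hd' hne heq

end Density

section Heights

open NumberField Height

variable {K : Type*} [Field K] [NumberField K]

lemma finsum_posLog_inv_natCast {p : ℕ} (hp : p ≠ 0) :
    ∑ᶠ w : FinitePlace K, Real.posLog (w (p : K)⁻¹) = Module.finrank ℚ K * Real.log p := by
  have hp1 : (1 : ℝ) ≤ p := Nat.one_le_cast.mpr (Nat.one_le_iff_ne_zero.mpr hp)
  have hinf : ∀ w : InfinitePlace K, w (p : K) = p := fun w => by
    rw [← InfinitePlace.norm_embedding_eq, map_natCast, Complex.norm_natCast]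
  have hfinite : ∑ᶠ w : FinitePlace K, Real.posLog (w (p : K)) = 0 :=
    finsum_eq_zero_of_forall_eq_zero fun w => by
      have hw : IsNonarchimedean w.val := fun x y => FinitePlace.add_le w x y
      rw [Real.posLog_eq_zero_iff, abs_of_nonneg (apply_nonneg w _)]
      exact hw.apply_natCast_le_one
  have hinfinite : ∑ w : InfinitePlace K, w.mult * Real.posLog (w (p : K)) =
      Module.finrank ℚ K * Real.log p := by
    rw [← InfinitePlace.sum_mult_eq, Nat.cast_sum, Finset.sum_mul]
    refine Finset.sum_congr rfl fun w _ => ?_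
    rw [hinf, Real.posLog_eq_log (by rwa [Nat.abs_cast])]
  have hinfinite_inv : ∑ w : InfinitePlace K, w.mult * Real.posLog (w (p : K)⁻¹) = 0 :=
    Finset.sum_eq_zero fun w _ => by
      rw [map_inv₀, hinf, (Real.posLog_eq_zero_iff _).mpr, mul_zero]
      rw [abs_inv, Nat.abs_cast]
      exact inv_le_one_of_one_le₀ hp1
  calc _ = logHeight₁ (p : K)⁻¹ := by rw [NumberField.logHeight₁_eq, hinfinite_inv, zero_add]
    _ = logHeight₁ (p : K) := logHeight₁_inv _
    _ = _ := by rw [NumberField.logHeight₁_eq, hinfinite, hfinite, add_zero]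

lemma hasFiniteSupport_posLog {x : K} (hx : x ≠ 0) :
    Function.HasFiniteSupport fun w : FinitePlace K => Real.posLog (w x) :=
  (FinitePlace.hasFiniteMulSupport hx).subset fun w hw h => hw (by
    simp only at h ⊢
    rw [h, Real.posLog_one])

lemma mul_log_le_logHeight₁ {p : ℕ} (hp : p ≠ 0) {e : ℝ} {x : K} (hx : x ≠ 0)
    (h : ∀ w : FinitePlace K, w (p : K) < 1 → e * -Real.log (w (p : K)) ≤ Real.log (w x)) :
    e * (Module.finrank ℚ K * Real.log p) ≤ logHeight₁ x := by
  have hp0 : (p : K) ≠ 0 := Nat.cast_ne_zero.mpr hp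
  have hlocal : ∀ w : FinitePlace K,
      e * Real.posLog (w (p : K)⁻¹) ≤ Real.posLog (w x) := fun w => by
    have hw0 : 0 < w (p : K) := FinitePlace.pos_iff.mpr hp0
    rcases lt_or_ge (w (p : K)) 1 with hw | hw
    · rw [map_inv₀, Real.posLog_eq_log, Real.log_inv]
      · exact (h w hw).trans (le_max_right _ _)
      · rw [abs_of_pos (inv_pos.mpr hw0)]
        exact (one_le_inv₀ hw0).mpr hw.le
    · rw [(Real.posLog_eq_zero_iff (w (p : K)⁻¹)).mpr, mul_zero]
      · exact Real.posLog_nonneg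
      · rw [abs_of_nonneg (apply_nonneg w _), map_inv₀]
        exact inv_le_one_of_one_le₀ hw
  have hsupport : Function.HasFiniteSupport
      fun w : FinitePlace K => e * Real.posLog (w (p : K)⁻¹) :=
    (hasFiniteSupport_posLog (inv_ne_zero hp0)).subset fun w hw h => hw (by
      simp only at h ⊢
      rw [h, mul_zero])
  calc e * (Module.finrank ℚ K * Real.log p)
      = ∑ᶠ w : FinitePlace K, e * Real.posLog (w (p : K)⁻¹) := by
        rw [← finsum_posLog_inv_natCast hp, mul_finsum]
    _ ≤ ∑ᶠ w : FinitePlace K, Real.posLog (w x) :=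
        finsum_le_finsum' hsupport (hasFiniteSupport_posLog hx) hlocal
    _ ≤ logHeight₁ x := by
        rw [NumberField.logHeight₁_eq]
        exact le_add_of_nonneg_left
          (Finset.sum_nonneg fun w _ => mul_nonneg (Nat.cast_nonneg _) Real.posLog_nonneg)

lemma rep_mem_coordField (P : P2 Qbar) (i : Fin 3) : P.rep i ∈ coordField P :=
  IntermediateField.subset_adjoin ℚ _ ⟨i, rfl⟩

lemma coords_mem_coordField (P : P2 Qbar) (i : Fin 2) : coords P i ∈ coordField P := by
  fin_cases i <;> simp only [coords, imageCoords, eval_X] <;>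
    exact div_mem (rep_mem_coordField P _) (rep_mem_coordField P _)

lemma logHeight₁_le_naiveHeight {P : P2 Qbar} {x : coordField P} (hx : (x : Qbar) = coords P 0) :
    logHeight₁ x ≤ Module.finrank ℚ (coordField P) * naiveHeight P := by
  let r : Fin 3 → coordField P := fun i => ⟨P.rep i, rep_mem_coordField P i⟩
  have hdiv : x = r 0 / r 2 := Subtype.ext (by simp [hx, coords, imageCoords, r])
  have hcomp : r ∘ ![(0 : Fin 3), 2] = ![r 0, r 2] := by
    funext i
    fin_cases i <;> rfl
  have hfinrank : (Module.finrank ℚ (coordField P) : ℝ) ≠ 0 :=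
    Nat.cast_ne_zero.mpr Module.finrank_pos.ne'
  calc logHeight₁ x ≤ logHeight r := by
        rw [hdiv, logHeight₁_div_eq_logHeight, ← hcomp]
        exact logHeight_comp_le _ r
    _ = _ := (mul_div_cancel₀ _ hfinrank).symm

end Heights

section Orbit

lemma IsPreimage.mem {k S : Type*} [Field k] [SetLike S k] [SubfieldClass S k] {F : S} {m : ℕ}
    {c : k} {w z : Fin 2 → k} (h : IsPreimage m c w z) (hc : c ∈ F) (hz1 : z 1 ≠ 0)
    (hz : ∀ i, z i ∈ F) : ∀ i, w i ∈ F := by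
  have hw1 : w 1 ∈ F := h.1 ▸ hz 0
  have hw0 : w 0 = w 1 ^ (m + 3) / z 1 ^ 2 - c := by
    rw [← h.2, mul_div_cancel_right₀ _ (pow_ne_zero 2 hz1), add_sub_cancel_right]
  rw [Fin.forall_fin_two, hw0]
  exact ⟨sub_mem (div_mem (pow_mem hw1 _) (pow_mem (hz 1) _)) hc, hw1⟩

variable {a : ℕ → Qbar}

lemma window_mem_coordField (hrel : ∀ j, IsPreimage 1 (1 / 2) (window a j) (window a (j + 1)))
    (hne : ∀ j, a j ≠ 0) {n j : ℕ} (hj : j ≤ n) :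
    ∀ i, window a j i ∈ coordField (chart (window a n)) := by
  induction hj using Nat.decreasingInduction with
  | self =>
    intro i
    simpa only [coords_chart] using coords_mem_coordField (chart (window a n)) i
  | of_succ j _ ih =>
    exact (hrel j).mem (div_mem (one_mem _) (ofNat_mem _ 2)) (hne (j + 2)) ih

lemma exists_lift_coordField (hrel : ∀ j, IsPreimage 1 (1 / 2) (window a j) (window a (j + 1)))
    (hne : ∀ j, a j ≠ 0) (n : ℕ) :
    ∃ b : ℕ → coordField (chart (window a n)), ∀ j ≤ n + 1, (b j : Qbar) = a j := by
  have hmem : ∀ j ≤ n + 1, a j ∈ coordField (chart (window a n)) := fun j hj => by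
    rcases Nat.le_succ_iff.mp hj with hj | rfl
    exacts [window_mem_coordField hrel hne hj 0, window_mem_coordField hrel hne le_rfl 1]
  choose! b hb using fun j hj =>
    CanLift.prf (β := coordField (chart (window a n))) (a j) (hmem j hj)
  exact ⟨b, hb⟩

lemma orbitExponent_mul_log_le_naiveHeight (h0 : a 0 = -a 1) (h1 : a 1 ^ 2 = a 1 + 1 / 2)
    (hrel : ∀ j, IsPreimage 1 (1 / 2) (window a j) (window a (j + 1))) (hne : ∀ j, a j ≠ 0)
    (n : ℕ) : orbitExponent n * Real.log 3 ≤ naiveHeight (chart (window a (n + 2))) := by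
  set P := chart (window a (n + 2)) with hP
  obtain ⟨b, hb⟩ : ∃ b : ℕ → coordField P, ∀ j ≤ n + 3, (b j : Qbar) = a j :=
    exists_lift_coordField hrel hne (n + 2)
  have hbrel : ∀ j < n + 2, IsPreimage 1 (1 / 2) (window b j) (window b (j + 1)) := fun j hj => by
    refine ⟨rfl, Subtype.ext ?_⟩
    simp only [window, Matrix.cons_val_zero, Matrix.cons_val_one]
    push_cast
    rw [hb j (by omega), hb (j + 1) (by omega), hb (j + 1 + 1) (by omega)]
    exact (hrel j).2
  have hb0 : b 0 = -b 1 := Subtype.ext (by simpa [hb 0, hb 1] using h0)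
  have hb1 : b 1 ^ 2 = b 1 + 1 / 2 := Subtype.ext (by
    push_cast
    rw [hb 1 (by omega)]
    exact h1)
  have hbn : b (n + 2) ≠ 0 := fun h => hne (n + 2) (by rw [← hb (n + 2) (by omega), h]; rfl)
  have hheight := mul_log_le_logHeight₁ (p := 3) three_ne_zero hbn fun w hw =>
    (log_absoluteValue_backward_sequence (fun x y => NumberField.FinitePlace.add_le w x y) hw
      three_ne_zero hb0 hb1 hbrel).1.ge
  have hnaive := hheight.trans (logHeight₁_le_naiveHeight (P := P) (by
    rw [hb (n + 2) (by omega), hP, coords_chart]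
    rfl))
  have hfinrank : (0 : ℝ) < Module.finrank ℚ (coordField P) :=
    Nat.cast_pos.mpr Module.finrank_pos
  push_cast at hnaive
  refine le_of_mul_le_mul_left ?_ hfinrank
  linarith

end Orbit

section BackwardOrbit

variable {m p : ℕ} {α : Qbar}

lemma exists_absoluteValue_fixedPoint (hm : m ≠ 0) (hp : p.Prime)
    (hα : α ^ (m + 1) = α + 1 / (p : Qbar) ^ m) :
    ∃ v : AbsoluteValue Qbar ℝ, IsNonarchimedean v ∧ v α < v (1 / (p : Qbar) ^ m) ∧
      v α ^ (m + 1) = v (1 / (p : Qbar) ^ m) := by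
  have : Fact p.Prime := ⟨hp⟩
  have : Algebra.IsAlgebraic ℚ Qbar := AlgebraicClosure.isAlgebraic ℚ
  obtain ⟨v, hv, hvp⟩ := exists_padic_absoluteValue (k := Qbar) p
  have hc : v (1 / (p : Qbar) ^ m) = (p : ℝ) ^ m := by
    rw [one_div, map_inv₀, map_pow, hvp, inv_pow, inv_inv]
  exact ⟨v, hv, absoluteValue_fixedPoint hv hm
    (hc ▸ one_lt_pow₀ (Nat.one_lt_cast.mpr hp.one_lt) hm) hα⟩

lemma chart_fixedPoint_mem_backLocus (hm : m ≠ 0) (hp : p.Prime)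
    (hα : α ^ (m + 1) = α + 1 / (p : Qbar) ^ m) :
    chart ![α, α] ∈ backLocus (recurrenceMap m (1 / (p : Qbar) ^ m)) := by
  obtain ⟨v, hv, hlt, hpow⟩ := exists_absoluteValue_fixedPoint hm hp hα
  have hc : 1 / (p : Qbar) ^ m ≠ 0 :=
    one_div_ne_zero (pow_ne_zero m (Nat.cast_ne_zero.mpr hp.ne_zero))
  exact chart_mem_backLocus hc fun n =>
    eval_branchPoly_ne_zero_of_absoluteValue hv hlt hpow n rfl rfl

lemma isPreimage_fixedPoint {k : Type*} [Field k] {c α β : k} (hα : α ^ (m + 1) = α + c)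
    (hβ : β ^ 2 = α ^ 2) : IsPreimage m c ![α, α] ![α, β] := by
  refine ⟨rfl, ?_⟩
  simp only [Matrix.cons_val_zero, Matrix.cons_val_one]
  rw [hβ, ← hα, ← pow_add]

lemma exists_backward_sequence_fixedPoint (hα : α ^ 2 = α + 1 / 2) :
    ∃ a : ℕ → Qbar, window a 0 = ![α, α] ∧ window a 2 = ![-α, α] ∧ (∀ j, a j ≠ 0) ∧
      ∀ j, IsPreimage 1 (1 / 2) (window a j) (window a (j + 1)) := by
  obtain ⟨v, hv, hlt, hpow⟩ :=
    exists_absoluteValue_fixedPoint (m := 1) one_ne_zero Nat.prime_two (by simpa using hα)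
  rw [pow_one, Nat.cast_two] at hlt hpow
  have hα0 : α ≠ 0 := v.ne_zero_iff.mp (absoluteValue_ne_zero_of_pow_eq hlt hpow)
  obtain ⟨b, hb0, hb, hrel⟩ :=
    exists_backward_sequence (w := ![-α, α]) hv hlt hpow (v.map_neg α) rfl
  have hb00 : b 0 = -α := congrFun hb0 0
  have hb01 : b 1 = α := congrFun hb0 1
  let a : ℕ → Qbar
    | 0 => α
    | 1 => α
    | j + 2 => b j
  refine ⟨a, rfl, hb0, fun j => ?_, fun j => ?_⟩
  · match j with
    | 0 => exact hα0
    | 1 => exact hα0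
    | j + 2 => exact v.ne_zero_iff.mp (hb j ▸ v.ne_zero hα0)
  · match j with
    | 0 => exact isPreimage_fixedPoint hα ((congrArg (· ^ 2) hb00).trans (neg_sq α))
    | 1 =>
      refine ⟨rfl, ?_⟩
      change (α + 1 / 2) * b 1 ^ 2 = b 0 ^ 4
      rw [hb00, hb01, ← hα]
      ring
    | j + 2 => exact hrel j

variable {a : ℕ → Qbar}

lemma dense_range_chart_window (h0 : a 0 = -a 1) (h1 : a 1 ^ 2 = a 1 + 1 / 2)
    (hne : ∀ j, a j ≠ 0) (hrel : ∀ j, IsPreimage 1 (1 / 2) (window a j) (window a (j + 1))) :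
    @Dense _ (plane Qbar).top (Set.range fun n => chart (window a (n + 2))) := by
  have : Algebra.IsAlgebraic ℚ Qbar := AlgebraicClosure.isAlgebraic ℚ
  obtain ⟨v, hv, hv3⟩ := exists_padic_absoluteValue (k := Qbar) 3
  rw [Nat.cast_ofNat, Nat.cast_ofNat] at hv3
  have hlt : v 3 < 1 := by
    rw [hv3]
    norm_num
  have hlog : 0 < -Real.log (v 3) := neg_pos.mpr (Real.log_neg (v.pos three_ne_zero) hlt)
  refine dense_range_chart hv (fun n => Fin.forall_fin_two.mpr ⟨hne (n + 2), hne (n + 3)⟩)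
    fun hab => ((tendsto_abs_linear_orbitExponent hab).atTop_mul_const hlog).congr fun n => ?_
  obtain ⟨hn, hn'⟩ := log_absoluteValue_backward_sequence hv hlt three_ne_zero h0 h1
    (n := n) fun j _ => hrel j
  simp only [window, Matrix.cons_val_zero, Matrix.cons_val_one]
  rw [hn, hn', ← abs_of_pos hlog, ← abs_mul, abs_of_pos hlog]
  ring_nf

lemma tendsto_naiveHeight_chart_window (h0 : a 0 = -a 1) (h1 : a 1 ^ 2 = a 1 + 1 / 2)
    (hne : ∀ j, a j ≠ 0) (hrel : ∀ j, IsPreimage 1 (1 / 2) (window a j) (window a (j + 1))) :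
    Tendsto (fun n => naiveHeight (chart (window a n))) atTop atTop :=
  (tendsto_add_atTop_iff_nat 2).mp <|
    tendsto_atTop_mono (orbitExponent_mul_log_le_naiveHeight h0 h1 hrel hne)
      (tendsto_orbitExponent.atTop_mul_const (Real.log_pos (by norm_num)))

lemma exists_dense_unbounded_backward_orbit (hα : α ^ 2 = α + 1 / 2) :
    ∃ P : ℕ → P2 Qbar, P 0 = chart ![α, α] ∧
      (∀ n, Sends (recurrenceMap 1 (1 / 2)) (P (n + 1)) (P n)) ∧
      @Dense _ (plane Qbar).top (Set.range P) ∧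
      Tendsto (fun n => naiveHeight (P n)) atTop atTop := by
  obtain ⟨a, ha0, ha2, hne, hrel⟩ := exists_backward_sequence_fixedPoint hα
  have h2 : a 2 = -a 3 := (congrFun ha2 0).trans (congrArg Neg.neg (congrFun ha2 1)).symm
  have h3 : a 3 ^ 2 = a 3 + 1 / 2 := by
    rw [show a 3 = α from congrFun ha2 1]
    exact hα
  refine ⟨fun n => chart (window a n), congrArg chart ha0,
    fun n => sends_chart_of_isPreimage (hrel n) (hne (n + 2)), ?_, ?_⟩
  · let _ := (plane Qbar).top
    refine Dense.mono ?_ (dense_range_chart_window (a := fun j => a (j + 2)) h2 h3 (fun j => hne _)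
      fun j => hrel (j + 2))
    rintro _ ⟨n, rfl⟩
    exact ⟨n + 4, rfl⟩
  · exact (tendsto_add_atTop_iff_nat 2).mp <| tendsto_naiveHeight_chart_window
      (a := fun j => a (j + 2)) h2 h3 (fun j => hne _) fun j => hrel (j + 2)

end BackwardOrbit

lemma affinePoint_eq_chart (a b : Qbar) : affinePoint a b = chart ![a, b] := rfl

lemma fMap_add_three (m p : ℕ) : fMap (m + 3) p = recurrenceMap m (1 / (p : Qbar) ^ m) := rfl

theorem theorem4p1_general :
    (∀ {k : Type*} [Field k] [IsAlgClosed k] [NeZero (2 : k)] (m : ℕ) {c : k}, c ≠ 0 →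
      HasDynDegree (recurrenceMap m c) 1 (m + 3 : ℕ) ∧ HasDynDegree (recurrenceMap m c) 2 2 ∧
        IsCohHyperbolic (recurrenceMap m c) 1) ∧
    (∀ {α : Qbar}, α ^ 2 = α + 1 / 2 →
      Sends (fMap 4 2) (affinePoint α α) (affinePoint α α) ∧
      affinePoint α α ∈ backLocus (fMap 4 2) ∧
      ∃ P : ℕ → P2 Qbar, P 0 = affinePoint α α ∧
        (∀ n, 1 ≤ n → P n ∉ indet (fMap 4 2) ∧ Sends (fMap 4 2) (P n) (P (n - 1))) ∧
        @Dense _ (plane Qbar).top (Set.range P) ∧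
        Tendsto (fun n => naiveHeight (P n)) atTop atTop) := by
  refine ⟨fun m c hc => ⟨hasDynDegree_recurrenceMap_one hc, hasDynDegree_recurrenceMap_two,
    isCohHyperbolic_recurrenceMap hc⟩, fun {α} hα => ?_⟩
  have hf := fMap_add_three 1 2
  have hα0 : α ≠ 0 := by
    rintro rfl
    norm_num at hα
  have hback := chart_fixedPoint_mem_backLocus one_ne_zero Nat.prime_two (by simpa using hα)
  rw [pow_one, Nat.cast_two] at hf hback
  rw [hf, affinePoint_eq_chart]
  obtain ⟨P, hP0, hP, hdense, hheight⟩ := exists_dense_unbounded_backward_orbit hα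
  refine ⟨sends_chart_of_isPreimage (isPreimage_fixedPoint hα rfl) hα0, hback, P, hP0,
    fun n hn => ?_, hdense, hheight⟩
  obtain ⟨n, rfl⟩ := Nat.exists_eq_add_of_le' hn
  exact ⟨notMem_indet (hP n), hP n⟩

end UnbddPreper

end

open UnbddPreper in
theorem theorem4p1 :
    (∀ d p : ℕ, 3 ≤ d → p.Prime →
      HasDynDegree (fMap d p) 1 d ∧ HasDynDegree (fMap d p) 2 2 ∧
        IsCohHyperbolic (fMap d p) 1) ∧
    (∀ s : Qbar, s ^ 2 = 3 →
      Sends (fMap 4 2) (affinePoint ((1 + s) / 2) ((1 + s) / 2))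
        (affinePoint ((1 + s) / 2) ((1 + s) / 2)) ∧
      affinePoint ((1 + s) / 2) ((1 + s) / 2) ∈ backLocus (fMap 4 2) ∧
      ∃ P : ℕ → P2 Qbar, P 0 = affinePoint ((1 + s) / 2) ((1 + s) / 2) ∧
        (∀ n, 1 ≤ n → P n ∉ indet (fMap 4 2) ∧ Sends (fMap 4 2) (P n) (P (n - 1))) ∧
        @Dense _ (plane Qbar).top (Set.range P) ∧
        Tendsto (fun n => naiveHeight (P n)) atTop atTop) := by
  obtain ⟨hdegree, horbit⟩ := theorem4p1_general
  refine ⟨fun d p hd hp => ?_, fun s hs => horbit (by linear_combination hs / 4)⟩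
  obtain ⟨m, rfl⟩ := Nat.exists_eq_add_of_le' hd
  exact hdegree m (one_div_ne_zero (pow_ne_zero m (Nat.cast_ne_zero.mpr hp.ne_zero)))
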